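/- **Setting.** For $w\in\{0,1,\diamond\}^*$ let the truestring $T(w)$ be the subsequence obtained by deleting all $\diamond$ characters; $w,v$ are truestring equivalent if $T(w)=T(v)$. Let $\mathrm{TE}(n)$ be the set of truestring equivalent pairs $(w,v)$ of strings of length $n$ over $\{0,1,\diamond\}$. A pair (which has $2n$ positions) is $\varepsilon$-far from $\mathrm{TE}(n)$ if its Hamming distance to every member of $\mathrm{TE}(n)$ is larger than $\varepsilon\cdot 2n$. A (randomized, adaptive) query algorithm reads the input one position at a time; it is a probability distribution over deterministic decision trees, and it makes at most $q$ queries if this holds for every input and every outcome of its coin tosses. It is an $\varepsilon$-tester for $\mathrm{TE}(n)$ with bounded error $\eta$ if it accepts each member of $\mathrm{TE}(n)$ with probability at least $1-\eta$ and rejects each pair that is $\varepsilon$-far from $\mathrm{TE}(n)$ with probability at least $1-\eta$. For $u\in\{0,1\}^n$ and $U\subseteq\{1,\dots,2n\}$ with $|U|=n$, let $S(u,U)\in\{0,1,\diamond\}^{2n}$ be the unique string with $U=\{i: S(u,U)[i]=\diamond\}$ and $T(S(u,U))=u$. Let $u\in\{0,1\}^n$ be uniformly random, let $u'$ be obtained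 from $u$ by replacing $u[i]$, for each $2n/5<i<3n/5$, by a fresh independent uniform bit, and let $U,U'$ be independent random sets, each obtained by putting, for each $1\le i\le n$ independently, exactly one of $i$ and $2n+1-i$ into the set, with probability $1/2$ each ($u,u',U,U'$ are otherwise independent). Let $\mathcal D_P$ be the distribution of $(S(u,U),S(u,U'))$ and $\mathcal D_N$ that of $(S(u,U),S(u',U'))$. **Theorem.** 1. Testing truestring equivalence requires $\Omega(n^{1/5})$ queries. That is, there is a constant $\varepsilon_0>0$ such that for every $\eta\in[0,1/2)$ (for instance $\eta=1/3$) there is a constant $c>0$ such that, for all sufficiently large $n$ and all $0<\varepsilon\le\varepsilon_0$, every $\varepsilon$-tester for $\mathrm{TE}(n)$ with bounded error $\eta$ that makes at most $q$ queries satisfies $q\ge c\,n^{1/5}$. 2. If $q(n)=o(n^{1/5})$ and, for each $n$, $\mathcal A_n$ is a query algorithm for pairs of strings of length $2n$ that makes at most $q(n)$ queries, then $$\Pr_{(w,w')\sim\mathcal D_P}[\mathcal A_n\text{ accepts }(w,w')]-\Pr_{(w,w')\sim\mathcal D_N}[\mathcal A_n\text{ accepts }(w,w')]\longrightarrow 0\qquad(n\to\infty).$$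 -/

import Mathlib

open Filter Topology Asymptotics

noncomputable section

namespace PropertyTesting

/-- A deterministic adaptive query algorithm on inputs `x : I → A` (strings over the alphabet `A`
with positions `I`): it either stops with an answer (`true` means accept), or queries a position
and continues in a way that depends on the symbol that it has read. -/
inductive DecisionTree (I A : Type) : Type
  | leaf (accept : Bool) : DecisionTree I A
  | query (i : I) (next : A → DecisionTree I A) : DecisionTree I A

/-- The answer of the algorithm on the input `x`. -/
def DecisionTree.eval {I A : Type} : DecisionTree I A → (I → A) → Bool
  | .leaf b, _ => b
  | .query i next, x => (next (x i)).eval x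

/-- The number of queries that the algorithm makes on the input `x`. -/
def DecisionTree.numQueries {I A : Type} : DecisionTree I A → (I → A) → ℕ
  | .leaf _, _ => 0
  | .query i next, x => (next (x i)).numQueries x + 1

/-- A randomized query algorithm: a probability distribution over deterministic ones. (For finite
`I` and `A` there are countably many decision trees, so every distribution is a `PMF`.) -/
abbrev RandomizedAlgorithm (I A : Type) : Type := PMF (DecisionTree I A)

/-- The algorithm makes at most `q` queries, whatever the input and its coin tosses are. -/
def MakesAtMost {I A : Type} (𝒜 : RandomizedAlgorithm I A) (q : ℕ) : Prop :=
  ∀ t ∈ 𝒜.support, ∀ x : I → A, t.numQueries x ≤ q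

/-- The probability that the algorithm accepts the input `x`. -/
def acceptProb {I A : Type} (𝒜 : RandomizedAlgorithm I A) (x : I → A) : ℝ :=
  ((𝒜.map fun t => t.eval x) true).toReal

/-- The probability that the algorithm accepts an input drawn (independently of its coin tosses)
from the distribution `𝒟`. -/
def acceptProbOn {I A : Type} (𝒜 : RandomizedAlgorithm I A) (𝒟 : PMF (I → A)) : ℝ :=
  ((𝒟.bind fun x => 𝒜.map fun t => t.eval x) true).toReal

/-- `x` is `ε`-far from `L`: its Hamming distance to each member of `L` is larger than `ε` times
the number of positions. -/
def IsFar {I A : Type} [Fintype I] [DecidableEq A] (ε : ℝ) (L : Set (I → A)) (x : I → A) : Prop :=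
  ∀ y ∈ L, ε * (Fintype.card I : ℝ) < (hammingDist x y : ℝ)

/-- `𝒜` is an `ε`-tester for `L` with bounded error `η`. -/
structure IsTester {I A : Type} [Fintype I] [DecidableEq A] (L : Set (I → A)) (ε η : ℝ)
    (𝒜 : RandomizedAlgorithm I A) : Prop where
  accepts_mem : ∀ x ∈ L, 1 - η ≤ acceptProb 𝒜 x
  rejects_far : ∀ x, IsFar ε L x → 1 - η ≤ 1 - acceptProb 𝒜 x

/-- The alphabet `{0, 1, ⋄}`: `some false` is `0`, `some true` is `1`, and `none` is `⋄`. -/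
abbrev TernarySymbol : Type := Option Bool

/-- Positions of a pair of strings of length `n` (`inl` for the first, `inr` for the second). -/
abbrev PairIndex (n : ℕ) : Type := Fin n ⊕ Fin n

/-- The truestring: the subsequence that remains when all `⋄` are deleted. -/
def truestring {n : ℕ} (w : Fin n → TernarySymbol) : List Bool := (List.ofFn w).reduceOption

/-- The language of truestring equivalent pairs `(w, v)` of strings of length `n`, where a pair is
given as the function `Sum.elim w v` on its `2 n` positions. -/
def truestringEquivalence (n : ℕ) : Set (PairIndex n → TernarySymbol) :=
  {x | truestring (fun i => x (Sum.inl i)) = truestring (fun i => x (Sum.inr i))}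

/-- The string `S(u, U)` of length `2 n` whose set of `⋄`-positions is `U` and whose truestring is
`u`, for a set `U` of exactly `n` positions: a position `i ∉ U` carries the `k`-th letter of `u`
(counted from `0`), where `k` is the number of positions before `i` that are not in `U`. -/
def spread {n : ℕ} (u : Fin n → Bool) (U : Finset (Fin (2 * n))) : Fin (2 * n) → TernarySymbol :=
  fun i => if i ∈ U then none else (List.ofFn u)[(Finset.univ.filter fun j => j < i ∧ j ∉ U).card]?

/-- The set that contains, for each mirror pair of positions `i < n` and `2 n - 1 - i` (counted
from `0`), the first one if `a i` is true and the second one otherwise. -/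
def mirrorSet {n : ℕ} (a : Fin n → Bool) : Finset (Fin (2 * n)) :=
  Finset.univ.filter fun i =>
    if h : i.val < n then a ⟨i.val, h⟩ = true
    else a ⟨2 * n - 1 - i.val, by omega⟩ = false

/-- The string `u` with its letters at the positions `j`, `2 n / 5 < j < 3 n / 5` (counted
from `1`), replaced by those of `r`. -/
def resample {n : ℕ} (u r : Fin n → Bool) : Fin n → Bool :=
  fun i => if 2 * n < 5 * (i.val + 1) ∧ 5 * (i.val + 1) < 3 * n then r i else u i

/-- The positive distribution, on pairs of strings of length `2 n`: `(S(u, U), S(u, U'))` for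
independent uniform `u`, `U`, `U'`. -/
def positiveDist (n : ℕ) : PMF (PairIndex (2 * n) → TernarySymbol) :=
  (PMF.uniformOfFintype ((Fin n → Bool) × (Fin n → Bool) × (Fin n → Bool))).map
    fun (u, a, b) => Sum.elim (spread u (mirrorSet a)) (spread u (mirrorSet b))

/-- The negative distribution, on pairs of strings of length `2 n`: `(S(u, U), S(u', U'))` for
independent uniform `u`, `U`, `U'`, where `u'` is `u` with its middle part drawn anew. -/
def negativeDist (n : ℕ) : PMF (PairIndex (2 * n) → TernarySymbol) :=
  (PMF.uniformOfFintype
      ((Fin n → Bool) × (Fin n → Bool) × (Fin n → Bool) × (Fin n → Bool))).map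
    fun (u, r, a, b) => Sum.elim (spread u (mirrorSet a)) (spread (resample u r) (mirrorSet b))

end PropertyTesting

end

open PropertyTesting

/-! Call the number of nonblank positions before a position its rank; it is the index of the letter
that a nonblank position carries. Cut an outer range of mirror pairs into `m` blocks of `2h`
consecutive mirror indices, all below `2n/5`. The coins of one block shift the ranks of all deeper
positions by a binomial amount, independently in the two strings. They do not affect positions
outside the block on the outer side, because each mirror pair carries exactly one letter however its
coin falls.

Hence an algorithm that never queries block `k` cannot align the two strings beyond it. Except with
probability `q²/√(2h+1)`, no letter is read at two queried positions of which one lies beyond the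
block (`prob_collide_le`), so the letters seen there look independent. This gives one hybrid close
to both distributions (`mul_prob_agrees_hybrid_le`), since positions on the outer side of the block
never carry redrawn letters. Some block is queried with probability at most `q/m`, so the advantage
is at most `2q²/√(2h+1) + q/m` (`prob_eval_sub_le`, `abs_prob_eval_sub_le`). Taking `m = K(q+1)` and
`mh ≈ n/5` turns this into `O(√(K(q+1)⁵/n)) + 1/K`, which is where the exponent `1/5` comes from.

For the tester bound, positive pairs are truestring equivalent, and negative pairs are far with
overwhelming probability (`prob_not_isFar_le`): for fixed blanks and a fixed first string, the
second one takes at least `2^(n/5-1)` values, and only an exponentially small fraction of them is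
near equivalence. A tester therefore distinguishes the two distributions. -/

namespace PropertyTesting

/-! ### Uniform probability on finite types -/

section Prob

open Classical in
/-- The probability of the event `E` under the uniform distribution on a finite type. -/
noncomputable def prob {Ω : Type*} [Fintype Ω] (E : Ω → Prop) : ℝ :=
  ((Finset.univ.filter E).card : ℝ) / Fintype.card Ω

variable {Ω Ω' : Type*} [Fintype Ω] [Fintype Ω']

theorem prob_nonneg (E : Ω → Prop) : 0 ≤ prob E := by unfold prob; positivity

theorem prob_mono {E F : Ω → Prop} (h : ∀ ω, E ω → F ω) : prob E ≤ prob F := by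
  unfold prob
  gcongr
  exact h _

theorem prob_congr {E F : Ω → Prop} (h : ∀ ω, E ω ↔ F ω) : prob E = prob F :=
  le_antisymm (prob_mono fun ω => (h ω).1) (prob_mono fun ω => (h ω).2)

theorem prob_false {E : Ω → Prop} (h : ∀ ω, ¬ E ω) : prob E = 0 := by
  simp [prob, h]

theorem prob_le_one (E : Ω → Prop) : prob E ≤ 1 := by
  unfold prob
  apply div_le_one_of_le₀ _ (by positivity)
  exact_mod_cast Finset.card_le_univ _

theorem prob_true [Nonempty Ω] {E : Ω → Prop} (h : ∀ ω, E ω) : prob E = 1 := by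
  simp [prob, h]

theorem prob_or_le (E F : Ω → Prop) : prob (fun ω => E ω ∨ F ω) ≤ prob E + prob F := by
  classical
  unfold prob
  rw [← add_div]
  gcongr
  refine le_trans ?_ (Nat.cast_le.2 (Finset.card_union_le _ _) |>.trans (Nat.cast_add _ _).le)
  gcongr
  intro ω h
  simpa using h

theorem sum_prob_and_eq {B : Type*} [Fintype B] (E : Ω → Prop) (f : Ω → B) :
    ∑ b, prob (fun ω => E ω ∧ f ω = b) = prob E := by
  classical
  unfold prob
  rw [← Finset.sum_div]
  congr 1
  rw [Finset.card_eq_sum_card_fiberwise (f := f) (t := Finset.univ) (by simp)]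
  push_cast
  refine Finset.sum_congr rfl fun b _ => ?_
  rw [Finset.filter_filter]
  congr

theorem prob_true_add_prob_false [Nonempty Ω] (f : Ω → Bool) :
    prob (fun ω => f ω = true) + prob (fun ω => f ω = false) = 1 := by
  have h := sum_prob_and_eq (fun _ : Ω => True) f
  rw [prob_true (fun _ => trivial)] at h
  simpa using h

theorem prob_equiv (e : Ω ≃ Ω') (E : Ω' → Prop) : prob (fun ω => E (e ω)) = prob E := by
  classical
  unfold prob
  rw [Fintype.card_congr e]
  congr 2
  exact Finset.card_bij (fun ω _ => e ω) (by simp) (by simp)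
    (fun b hb => ⟨e.symm b, by simpa using hb, by simp⟩)

theorem prob_comp_fst [Nonempty Ω'] (E : Ω → Prop) :
    prob (fun p : Ω × Ω' => E p.1) = prob E := by
  classical
  unfold prob
  have : (Finset.univ.filter fun p : Ω × Ω' => E p.1) = Finset.univ.filter E ×ˢ Finset.univ := by
    ext; simp
  have hc : (Fintype.card Ω' : ℝ) ≠ 0 := by simp
  rw [this, Finset.card_product, Fintype.card_prod]
  push_cast
  rw [Finset.card_univ, mul_div_mul_right _ _ hc]

theorem prob_prod_eq_sum (E : Ω → Ω' → Prop) :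
    prob (fun p : Ω × Ω' => E p.1 p.2) = (∑ ω, prob (E ω)) / Fintype.card Ω := by
  classical
  unfold prob
  rw [← Finset.sum_div, div_div, Fintype.card_prod]
  push_cast
  rw [mul_comm (Fintype.card Ω : ℝ)]
  congr 1
  rw [Finset.card_eq_sum_card_fiberwise (f := Prod.fst) (t := Finset.univ) (by simp)]
  push_cast
  refine Finset.sum_congr rfl fun b _ => ?_
  norm_cast
  rw [Finset.filter_filter]
  refine Finset.card_bij (fun p _ => p.2) ?_ ?_ ?_
  · rintro ⟨x, y⟩ h; simp at h ⊢; rw [← h.2]; exact h.1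
  · rintro ⟨x, y⟩ h ⟨x', y'⟩ h'; simp at h h' ⊢; intro h2; exact ⟨h.2.trans h'.2.symm, h2⟩
  · intro y hy; exact ⟨(b, y), by simpa using hy, rfl⟩

theorem prob_prod_le [Nonempty Ω] {E : Ω → Ω' → Prop} {c : ℝ} (h : ∀ ω, prob (E ω) ≤ c) :
    prob (fun p : Ω × Ω' => E p.1 p.2) ≤ c := by
  rw [prob_prod_eq_sum, div_le_iff₀ (by exact_mod_cast Fintype.card_pos)]
  calc _ ≤ ∑ ω : Ω, c := Finset.sum_le_sum fun ω _ => h ω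
    _ = _ := by simp [mul_comm]

/-- Double counting: each outcome lies in at most `q` of the events. This yields a block that is
rarely queried. -/
theorem sum_prob_le {B : Type*} (s : Finset B) (E : B → Ω → Prop) (q : ℕ)
    (h : ∀ ω, ∃ T : Finset B, T.card ≤ q ∧ ∀ b ∈ s, E b ω → b ∈ T) :
    ∑ b ∈ s, prob (E b) ≤ q := by
  classical
  unfold prob
  rw [← Finset.sum_div]
  apply div_le_of_le_mul₀ (by positivity) (by positivity)
  have : ∑ b ∈ s, (Finset.univ.filter (E b)).card ≤ q * Fintype.card Ω := by
    simp_rw [Finset.card_filter]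
    rw [Finset.sum_comm]
    refine (Finset.sum_le_card_nsmul Finset.univ _ q fun ω _ => ?_).trans
      (by simp [mul_comm])
    rw [← Finset.card_filter]
    obtain ⟨T, hT, hT'⟩ := h ω
    exact (Finset.card_le_card fun b hb => by
      rw [Finset.mem_filter] at hb; exact hT' b hb.1 hb.2).trans hT
  exact_mod_cast this

end Prob

/-! ### Decision trees and the hybrid argument -/

section Trees

variable {I A : Type}

/-- The set of positions that the algorithm queries on the input `x`. -/
noncomputable def DecisionTree.queried : DecisionTree I A → (I → A) → Finset I
  | .leaf _, _ => ∅
  | .query i next, x => by classical exact insert i ((next (x i)).queried x)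

theorem DecisionTree.card_queried_le (t : DecisionTree I A) (x : I → A) :
    (t.queried x).card ≤ t.numQueries x := by
  classical
  induction t with
  | leaf b => simp [queried]
  | query i next ih =>
    simp only [queried, numQueries]
    refine (Finset.card_insert_le _ _).trans ?_
    have := ih (x i)
    omega

open Classical in
/-- The tree `t` in which each query to a position in `J` is replaced by the answer `b`. -/
noncomputable def DecisionTree.prune (J : Set I) (b : Bool) : DecisionTree I A → DecisionTree I A
  | .leaf c => .leaf c
  | .query i next => if i ∈ J then .leaf b else .query i fun s => (next s).prune J b

/-- The two runs coincide until the first query in `J`, where the pruned one stops. -/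
theorem DecisionTree.eval_prune (J : Set I) (b : Bool) (t : DecisionTree I A) (x : I → A) :
    (t.prune J b).eval x = t.eval x ∨
      ((t.prune J b).eval x = b ∧ ∃ i ∈ t.queried x, i ∈ J) := by
  classical
  induction t with
  | leaf c => exact Or.inl rfl
  | query i next ih =>
    by_cases h : i ∈ J
    · right
      simp [prune, h, eval, queried]
    · simp only [prune, if_neg h, eval, queried, Finset.mem_insert]
      rcases ih (x i) with h1 | ⟨h1, j, h2, h3⟩
      · exact Or.inl h1
      · exact Or.inr ⟨h1, j, Or.inr h2, h3⟩

/-- The input `x` satisfies all the constraints in `C`; the constraint `(i, s)` says that the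
symbol at the position `i` is `s`. -/
def Agrees (C : Finset (I × A)) (x : I → A) : Prop := ∀ c ∈ C, x c.1 = c.2

/-- A leaf of the pruned tree is reached exactly when the answers on its path hold, and these are at
most `q` constraints outside `J`. So the bound for constraint sets adds up over the leaves with
answer `b'`. In the induction `C` is the path so far, and its size is charged to the query budget.
-/
theorem mul_prob_eval_prune_le [Fintype A] {Ω Ω' : Type*} [Fintype Ω] [Fintype Ω']
    (F : Ω → I → A) (F' : Ω' → I → A) (J : Set I) (q : ℕ) (δ : ℝ)
    (hC : ∀ C : Finset (I × A), C.card ≤ q → (∀ c ∈ C, c.1 ∉ J) →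
      (1 - δ) * prob (fun ω => Agrees C (F' ω)) ≤ prob (fun ω => Agrees C (F ω)))
    (b b' : Bool) (t : DecisionTree I A) (C : Finset (I × A)) (hCJ : ∀ c ∈ C, c.1 ∉ J)
    (ht : ∀ x, Agrees C x → t.numQueries x + C.card ≤ q) :
    (1 - δ) * prob (fun ω => Agrees C (F' ω) ∧ (t.prune J b).eval (F' ω) = b') ≤
      prob (fun ω => Agrees C (F ω) ∧ (t.prune J b).eval (F ω) = b') := by
  classical
  have hleaf : ∀ (C : Finset (I × A)) (t : DecisionTree I A), (∀ c ∈ C, c.1 ∉ J) →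
      (∀ x, Agrees C x → t.numQueries x + C.card ≤ q) → ∀ c : Bool,
      (1 - δ) * prob (fun ω => Agrees C (F' ω) ∧ c = b') ≤
        prob (fun ω => Agrees C (F ω) ∧ c = b') := by
    intro C t hCJ ht c
    by_cases hc : c = b'
    · by_cases hx : ∃ x, Agrees C x
      · obtain ⟨x, hx⟩ := hx
        have := ht x hx
        simpa [hc] using hC C (by omega) hCJ
      -- Repeated queries can make `C` contradictory. Then `ht` says nothing, but both probabilities
      -- vanish.
      · push Not at hx
        simp [hx, prob_false]
    · simp [hc, prob_false]
  induction t generalizing C with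
  | leaf c => exact hleaf C _ hCJ ht c
  | query i next ih =>
    by_cases h : i ∈ J
    · simp only [DecisionTree.prune, if_pos h]
      exact hleaf C _ hCJ ht b
    · simp only [DecisionTree.prune, if_neg h, DecisionTree.eval]
      rw [← sum_prob_and_eq _ (fun ω => F' ω i), ← sum_prob_and_eq _ (fun ω => F ω i),
        Finset.mul_sum]
      refine Finset.sum_le_sum fun s _ => ?_
      have key : ∀ x : I → A, ((Agrees C x ∧ ((next (x i)).prune J b).eval x = b') ∧ x i = s) ↔
          (Agrees (insert (i, s) C) x ∧ ((next s).prune J b).eval x = b') := by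
        intro x
        simp only [Agrees, Finset.forall_mem_insert]
        constructor
        · rintro ⟨⟨h1, h2⟩, rfl⟩; exact ⟨⟨rfl, h1⟩, h2⟩
        · rintro ⟨⟨rfl, h1⟩, h2⟩; exact ⟨⟨h1, h2⟩, rfl⟩
      rw [prob_congr fun ω => key (F' ω), prob_congr fun ω => key (F ω)]
      refine ih s (insert (i, s) C) ?_ ?_
      · rw [Finset.forall_mem_insert]; exact ⟨h, hCJ⟩
      · intro x hx
        simp only [Agrees, Finset.forall_mem_insert] at hx
        have h1 := ht x hx.2
        simp only [DecisionTree.numQueries, hx.1] at h1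
        have := Finset.card_insert_le (i, s) C
        omega

/-- The one-sided bound suffices: used for both answers, whose probabilities add up to 1, it bounds
acceptance from below and from above. -/
theorem abs_prob_eval_prune_sub_le [Fintype A] {Ω Ω' : Type*} [Fintype Ω] [Fintype Ω']
    [Nonempty Ω] [Nonempty Ω'] (F : Ω → I → A) (F' : Ω' → I → A) (J : Set I) (q : ℕ) (δ : ℝ)
    (hδ : 0 ≤ δ)
    (hC : ∀ C : Finset (I × A), C.card ≤ q → (∀ c ∈ C, c.1 ∉ J) →
      (1 - δ) * prob (fun ω => Agrees C (F' ω)) ≤ prob (fun ω => Agrees C (F ω)))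
    (b : Bool) (t : DecisionTree I A) (ht : ∀ x, t.numQueries x ≤ q) :
    |prob (fun ω => (t.prune J b).eval (F ω) = true) -
      prob (fun ω => (t.prune J b).eval (F' ω) = true)| ≤ δ := by
  have h := fun b' => mul_prob_eval_prune_le F F' J q δ hC b b' t ∅ (by simp)
    (fun x _ => by simpa using ht x)
  simp only [Agrees, Finset.notMem_empty, false_imp_iff, implies_true, true_and] at h
  have h1 := h true
  have h2 := h false
  have e1 := prob_true_add_prob_false fun ω => (t.prune J b).eval (F ω)
  have e2 := prob_true_add_prob_false fun ω => (t.prune J b).eval (F' ω)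
  have n1 := mul_le_of_le_one_right hδ (prob_le_one fun ω => (t.prune J b).eval (F' ω) = true)
  have n2 := mul_le_of_le_one_right hδ (prob_le_one fun ω => (t.prune J b).eval (F' ω) = false)
  rw [abs_le]
  constructor <;> linarith

/-- Two input distributions that are both close to the hybrid `F' k` on the positions outside the
set `{i | block i = k}`, for each `k < m`, are hard to distinguish. -/
theorem prob_eval_sub_le [Fintype A] {Ω₁ Ω₂ Ω' : Type*} [Fintype Ω₁] [Fintype Ω₂] [Fintype Ω']
    [Nonempty Ω₁] [Nonempty Ω₂] [Nonempty Ω'] (F₁ : Ω₁ → I → A) (F₂ : Ω₂ → I → A)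
    (F' : ℕ → Ω' → I → A) (block : I → ℕ) (m q : ℕ) (hm : 0 < m) (δ : ℝ) (hδ : 0 ≤ δ)
    (h₁ : ∀ k < m, ∀ C : Finset (I × A), C.card ≤ q → (∀ c ∈ C, block c.1 ≠ k) →
      (1 - δ) * prob (fun ω => Agrees C (F' k ω)) ≤ prob (fun ω => Agrees C (F₁ ω)))
    (h₂ : ∀ k < m, ∀ C : Finset (I × A), C.card ≤ q → (∀ c ∈ C, block c.1 ≠ k) →
      (1 - δ) * prob (fun ω => Agrees C (F' k ω)) ≤ prob (fun ω => Agrees C (F₂ ω)))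
    (t : DecisionTree I A) (ht : ∀ x, t.numQueries x ≤ q) :
    prob (fun ω => t.eval (F₁ ω) = true) ≤
      prob (fun ω => t.eval (F₂ ω) = true) + (2 * δ + q / m) := by
  classical
  -- Averaging over the blocks. Only `F₂` has to avoid block `k`: pruning with the answer `true` can
  -- only increase acceptance under `F₁`.
  obtain ⟨k, hk, hkq⟩ : ∃ k < m,
      prob (fun ω => ∃ i ∈ t.queried (F₂ ω), block i = k) ≤ (q : ℝ) / m := by
    have hs := sum_prob_le (Finset.range m)
      (fun k ω => ∃ i ∈ t.queried (F₂ ω), block i = k) q fun ω =>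
      ⟨(t.queried (F₂ ω)).image block,
        Finset.card_image_le.trans ((t.card_queried_le _).trans (ht _)), by
        rintro k - ⟨i, hi, rfl⟩; exact Finset.mem_image_of_mem _ hi⟩
    by_contra! hcon
    have : ∑ k ∈ Finset.range m, (q : ℝ) / m <
        ∑ k ∈ Finset.range m, prob (fun ω => ∃ i ∈ t.queried (F₂ ω), block i = k) :=
      Finset.sum_lt_sum_of_nonempty (by simpa using hm.ne')
        fun k hk => hcon k (Finset.mem_range.1 hk)
    rw [Finset.sum_const, Finset.card_range, nsmul_eq_mul, mul_div_cancel₀ _ (by positivity)]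
      at this
    linarith
  have a₁ := abs_prob_eval_prune_sub_le F₁ (F' k) {i | block i = k} q δ hδ (h₁ k hk) true t ht
  have a₂ := abs_prob_eval_prune_sub_le F₂ (F' k) {i | block i = k} q δ hδ (h₂ k hk) true t ht
  rw [abs_le] at a₁ a₂
  have b₁ : prob (fun ω => t.eval (F₁ ω) = true) ≤
      prob (fun ω => (t.prune {i | block i = k} true).eval (F₁ ω) = true) :=
    prob_mono fun ω h => by
      rcases t.eval_prune {i | block i = k} true (F₁ ω) with h' | h'
      · exact h'.trans h
      · exact h'.1
  have b₂ : prob (fun ω => (t.prune {i | block i = k} true).eval (F₂ ω) = true) ≤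
      prob (fun ω => t.eval (F₂ ω) = true) +
        prob (fun ω => ∃ i ∈ t.queried (F₂ ω), block i = k) :=
    (prob_mono fun ω h => by
      rcases t.eval_prune {i | block i = k} true (F₂ ω) with h' | h'
      · exact Or.inl (h'.symm.trans h)
      · exact Or.inr h'.2).trans (prob_or_le _ _)
  linarith [a₁.1, a₁.2, a₂.1, a₂.2]

end Trees

/-! ### Resampling a part of the randomness -/

section Resampling

variable {Ω Ω' X : Type*} [Fintype Ω] [Fintype Ω'] [Fintype X]

theorem prob_prod_mono {E F : Ω → Ω' → Prop} (h : ∀ ω, prob (E ω) ≤ prob (F ω)) :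
    prob (fun p : Ω × Ω' => E p.1 p.2) ≤ prob (fun p : Ω × Ω' => F p.1 p.2) := by
  rw [prob_prod_eq_sum, prob_prod_eq_sum]
  gcongr
  exact h _

theorem prob_prod_swap (E : Ω → Ω' → Prop) :
    prob (fun p : Ω × Ω' => E p.1 p.2) = prob (fun p : Ω' × Ω => E p.2 p.1) :=
  (prob_equiv (Equiv.prodComm Ω Ω') fun p : Ω' × Ω => E p.2 p.1)

/-- If resampling a part of `x` leaves the event `W` invariant and makes `E` unlikely, whatever the
rest is, then `E` is unlikely given `W`. -/
theorem prob_and_le_of_resample [Nonempty X] (o : X → X → X)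
    (ho : ∀ x y, o (o x y) (o y x) = x) (W E : X → Ω → Prop) (δ : ℝ)
    (hW : ∀ x y ω, W (o x y) ω ↔ W x ω) (hE : ∀ x ω, prob (fun y => E (o x y) ω) ≤ δ) :
    prob (fun p : X × Ω => W p.1 p.2 ∧ E p.1 p.2) ≤ δ * prob (fun p : X × Ω => W p.1 p.2) := by
  classical
  -- By `ho` this map is an involution, so it preserves the uniform measure. After applying it, `W`
  -- depends on `x` alone and `E` can be averaged over `y`.
  let e : (X × X) ≃ (X × X) :=
    ⟨fun p => (o p.1 p.2, o p.2 p.1), fun p => (o p.1 p.2, o p.2 p.1),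
      fun p => by simp [ho], fun p => by simp [ho]⟩
  have h1 : ∀ ω, prob (fun x => W x ω ∧ E x ω) ≤ δ * prob (fun x => W x ω) := by
    intro ω
    rw [← prob_comp_fst (Ω' := X) fun x => W x ω ∧ E x ω,
      ← prob_equiv e fun p : X × X => W p.1 ω ∧ E p.1 ω]
    simp only [e, Equiv.coe_fn_mk, hW]
    rw [prob_prod_eq_sum fun x y => W x ω ∧ E (o x y) ω, prob, ← mul_div_assoc]
    gcongr
    rw [Finset.card_filter, Nat.cast_sum, Finset.mul_sum]
    refine Finset.sum_le_sum fun x _ => ?_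
    by_cases hx : W x ω
    · simpa [hx] using hE x ω
    · simp [hx, prob_false]
  rw [prob_prod_swap fun x ω => W x ω ∧ E x ω, prob_prod_swap fun x ω => W x ω,
    prob_prod_eq_sum fun ω x => W x ω ∧ E x ω, prob_prod_eq_sum fun ω x => W x ω,
    ← mul_div_assoc, Finset.mul_sum]
  gcongr
  exact h1 _

theorem prob_exists_mem_le {B : Type*} (s : Finset B) (E : B → Ω → Prop) (δ : ℝ)
    (h : ∀ b ∈ s, prob (E b) ≤ δ) : prob (fun ω => ∃ b ∈ s, E b ω) ≤ s.card * δ := by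
  classical
  induction s using Finset.induction_on with
  | empty => simp [prob_false]
  | insert b s hb ih =>
    simp only [Finset.exists_mem_insert]
    refine (prob_or_le _ _).trans ?_
    rw [Finset.card_insert_of_notMem hb]
    push_cast
    have h1 := h b (Finset.mem_insert_self _ _)
    have h2 := ih fun c hc => h c (Finset.mem_insert_of_mem hc)
    linarith

end Resampling

/-! ### Anticoncentration of the binomial distribution -/

section Binomial

theorem card_filter_card_eq {α : Type*} [Fintype α] [DecidableEq α] (k : ℕ) :
    (Finset.univ.filter fun c : α → Bool => (Finset.univ.filter fun j => c j = false).card = k).card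
      = (Fintype.card α).choose k := by
  rw [← Finset.card_univ, ← Finset.card_powersetCard]
  refine Finset.card_bij (fun c _ => Finset.univ.filter fun j => c j = false) ?_ ?_ ?_
  · intro c hc
    simpa [Finset.mem_powersetCard] using hc
  · intro c _ c' _ h
    ext j
    have : j ∈ (Finset.univ.filter fun j => c j = false) ↔
      j ∈ (Finset.univ.filter fun j => c' j = false) := by rw [h]
    simp only [Finset.mem_filter, Finset.mem_univ, true_and] at this
    cases hc : c j <;> cases hc' : c' j <;> simp_all
  · intro s hs
    refine ⟨fun j => decide (j ∉ s), ?_, ?_⟩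
    · simpa [Finset.mem_powersetCard] using hs
    · ext j; simp

/-- By the recursion for central binomial coefficients, the induction step amounts to `(2h+1)(2h+3)
≤ (2h+2)²`. -/
theorem sq_centralBinom_mul_le (h : ℕ) : h.centralBinom ^ 2 * (2 * h + 1) ≤ (4 ^ h) ^ 2 := by
  induction h with
  | zero => simp
  | succ h ih =>
    have e := Nat.succ_mul_centralBinom_succ h
    refine Nat.le_of_mul_le_mul_left ?_ (show 0 < (h + 1) ^ 2 by positivity)
    calc (h + 1) ^ 2 * ((h + 1).centralBinom ^ 2 * (2 * (h + 1) + 1))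
        = ((h + 1) * (h + 1).centralBinom) ^ 2 * (2 * (h + 1) + 1) := by ring
      _ = (4 * (2 * h + 1) * (2 * h + 3)) * (h.centralBinom ^ 2 * (2 * h + 1)) := by
        rw [e]; ring
      _ ≤ (16 * (h + 1) ^ 2) * (4 ^ h) ^ 2 := Nat.mul_le_mul (by nlinarith) ih
      _ = _ := by ring

theorem centralBinom_div_le (h : ℕ) :
    (h.centralBinom : ℝ) / 4 ^ h ≤ 1 / √(2 * h + 1) := by
  rw [div_le_div_iff₀ (by positivity) (by positivity), one_mul]
  refine (sq_le_sq₀ (by positivity) (by positivity)).1 ?_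
  rw [mul_pow, Real.sq_sqrt (by positivity)]
  exact_mod_cast sq_centralBinom_mul_le h

/-- The bits outside `B` integrate out, and among the `2h` remaining ones the central value is the
most likely. -/
theorem prob_card_eq_le {α : Type*} [Fintype α] [DecidableEq α] (B : α → Prop) [DecidablePred B] (h k : ℕ)
    (hB : (Finset.univ.filter B).card = 2 * h) :
    prob (fun c : α → Bool => (Finset.univ.filter fun j => B j ∧ c j = false).card = k) ≤
      1 / √(2 * h + 1) := by
  refine le_trans ?_ (centralBinom_div_le h)
  have e : ∀ c : α → Bool, (Finset.univ.filter fun j => B j ∧ c j = false).card =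
      (Finset.univ.filter fun j : {j // B j} => (c j.1) = false).card := by
    intro c
    rw [← Finset.card_map ⟨Subtype.val, Subtype.val_injective⟩]
    congr 1
    ext j
    simp [and_comm]
  simp_rw [e]
  have e1 := prob_equiv (Equiv.piEquivPiSubtypeProd B fun _ => Bool)
    fun p => (Finset.univ.filter fun j => p.1 j = false).card = k
  simp only [Equiv.piEquivPiSubtypeProd, Equiv.coe_fn_mk] at e1
  rw [e1, prob_comp_fst fun p : {j // B j} → Bool =>
    (Finset.univ.filter fun j => p j = false).card = k, prob]
  have hcard : Fintype.card {j // B j} = 2 * h := by rw [Fintype.card_subtype, hB]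
  have := card_filter_card_eq (α := {j // B j}) k
  rw [hcard] at this
  have h4 : Fintype.card ({j // B j} → Bool) = 4 ^ h := by
    rw [Fintype.card_fun, hcard, Fintype.card_bool, pow_mul]
    norm_num
  rw [h4, Nat.cast_pow, Nat.cast_ofNat]
  gcongr
  convert (this.le.trans (Nat.choose_le_centralBinom k h))

end Binomial

/-! ### Ranks in a string with mirrored blanks -/

section Rank

variable {n : ℕ}

/-- The number of positions before `i` that are not in `U`. -/
def rank (U : Finset (Fin (2 * n))) (i : Fin (2 * n)) : ℕ :=
  (Finset.univ.filter fun j => j < i ∧ j ∉ U).card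

/-- The smaller one of the distances of the position `i` from the two ends. -/
def mirrorIndex (i : Fin (2 * n)) : ℕ := min i.val (2 * n - 1 - i.val)

/-- The bits `a`, with those at the positions `l ≤ j < r` replaced by those of `c`. -/
def override (l r : ℕ) (a c : Fin n → Bool) : Fin n → Bool :=
  fun j => if l ≤ j.val ∧ j.val < r then c j else a j

theorem override_override (l r : ℕ) (a c : Fin n → Bool) :
    override l r (override l r a c) (override l r c a) = a := by
  funext j
  simp only [override]
  split_ifs <;> rfl

theorem mem_mirrorSet_of_lt (a : Fin n → Bool) {i : Fin (2 * n)} (h : i.val < n) :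
    i ∈ mirrorSet a ↔ a ⟨i.val, h⟩ = true := by
  simp [mirrorSet, h]

theorem mem_mirrorSet_of_le (a : Fin n → Bool) {i : Fin (2 * n)} (h : n ≤ i.val) :
    i ∈ mirrorSet a ↔ a ⟨2 * n - 1 - i.val, by omega⟩ = false := by
  rw [mirrorSet, Finset.mem_filter, dif_neg (not_lt.2 h)]
  simp

theorem mem_mirrorSet_rev (a : Fin n → Bool) (i : Fin (2 * n)) :
    i.rev ∈ mirrorSet a ↔ i ∉ mirrorSet a := by
  have hi := i.2
  rcases lt_or_ge i.val n with h | h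
  · have h' : n ≤ i.rev.val := by rw [Fin.val_rev]; omega
    have e : (⟨2 * n - 1 - i.rev.val, by omega⟩ : Fin n) = ⟨i.val, h⟩ := by
      ext; simp only [Fin.val_rev]; omega
    rw [mem_mirrorSet_of_lt a h, mem_mirrorSet_of_le a h', e, Bool.not_eq_true]
  · have h' : i.rev.val < n := by rw [Fin.val_rev]; omega
    have e : (⟨i.rev.val, h'⟩ : Fin n) = ⟨2 * n - 1 - i.val, by omega⟩ := by
      ext; simp only [Fin.val_rev]; omega
    rw [mem_mirrorSet_of_le a h, mem_mirrorSet_of_lt a h', e, Bool.not_eq_false]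

theorem card_compl_mirrorSet (a : Fin n → Bool) : (mirrorSet a)ᶜ.card = n := by
  have h1 : (mirrorSet a)ᶜ.card = (mirrorSet a).card := by
    refine Finset.card_bij (fun i _ => i.rev) ?_ ?_ ?_
    · intro i hi; simpa [mem_mirrorSet_rev] using hi
    · intro i _ j _ h; simpa using h
    · intro i hi
      refine ⟨i.rev, ?_, by simp⟩
      rw [Finset.mem_compl, mem_mirrorSet_rev]; simpa using hi
  have h2 := Finset.card_compl_add_card (mirrorSet a)
  rw [Fintype.card_fin] at h2
  omega

theorem rank_lt_rank {U : Finset (Fin (2 * n))} {i j : Fin (2 * n)} (hi : i ∉ U) (h : i < j) :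
    rank U i < rank U j := by
  unfold rank
  apply Finset.card_lt_card
  rw [Finset.ssubset_iff]
  refine ⟨i, by simp, ?_⟩
  intro k
  simp only [Finset.mem_insert, Finset.mem_filter, Finset.mem_univ, true_and]
  rintro (rfl | ⟨h1, h2⟩)
  · exact ⟨h, hi⟩
  · exact ⟨h1.trans h, h2⟩

theorem rank_injOn {U : Finset (Fin (2 * n))} {i j : Fin (2 * n)} (hi : i ∉ U) (hj : j ∉ U)
    (h : rank U i = rank U j) : i = j := by
  rcases lt_trichotomy i j with h' | h' | h'
  · exact absurd h (rank_lt_rank hi h').ne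
  · exact h'
  · exact absurd h (rank_lt_rank hj h').ne'

/-- There are exactly `n` nonblank positions, so a rank can also be computed from the right end. -/
theorem rank_add_card (a : Fin n → Bool) (i : Fin (2 * n)) :
    rank (mirrorSet a) i + (Finset.univ.filter fun j => i ≤ j ∧ j ∉ mirrorSet a).card = n := by
  conv_rhs => rw [← card_compl_mirrorSet a]
  rw [rank, ← Finset.card_union_of_disjoint]
  · congr 1
    ext j
    simp only [Finset.mem_union, Finset.mem_filter, Finset.mem_univ, true_and, Finset.mem_compl]
    have := lt_or_ge j i
    tauto
  · rw [Finset.disjoint_left]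
    intro j
    simp only [Finset.mem_filter, Finset.mem_univ, true_and]
    intro h1 h2
    exact absurd h1.1 (not_lt.2 h2.1)

theorem rank_lt {a : Fin n → Bool} {i : Fin (2 * n)} (hi : i ∉ mirrorSet a) :
    rank (mirrorSet a) i < n := by
  have h := rank_add_card a i
  have : 0 < (Finset.univ.filter fun j => i ≤ j ∧ j ∉ mirrorSet a).card :=
    Finset.card_pos.2 ⟨i, by simpa using hi⟩
  omega

theorem rank_le (U : Finset (Fin (2 * n))) (i : Fin (2 * n)) : rank U i ≤ i.val := by
  refine (Finset.card_le_card (t := Finset.Iio i) fun j => by simp +contextual).trans ?_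
  simp

theorem rank_lt_or_le {a : Fin n → Bool} {i : Fin (2 * n)} {l : ℕ}
    (hl : mirrorIndex i < l) : rank (mirrorSet a) i < l ∨ n ≤ rank (mirrorSet a) i + l := by
  have h := rank_add_card a i
  have h1 := rank_le (mirrorSet a) i
  have h2 : (Finset.univ.filter fun j => i ≤ j ∧ j ∉ mirrorSet a).card ≤ 2 * n - i.val := by
    refine (Finset.card_le_card (t := Finset.Ici i) fun j => by simp +contextual).trans ?_
    simp
  have := i.2
  rcases min_lt_iff.1 hl with h3 | h3
  · left; omega
  · right; omega

theorem mem_mirrorSet_override {l r : ℕ} (a c : Fin n → Bool) {i : Fin (2 * n)}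
    (hi : mirrorIndex i < l ∨ r ≤ mirrorIndex i) :
    i ∈ mirrorSet (override l r a c) ↔ i ∈ mirrorSet a := by
  have := i.2
  unfold mirrorIndex at hi
  rcases lt_or_ge i.val n with h | h
  · rw [mem_mirrorSet_of_lt _ h, mem_mirrorSet_of_lt _ h, override, if_neg]
    show ¬ (l ≤ i.val ∧ i.val < r)
    omega
  · rw [mem_mirrorSet_of_le _ h, mem_mirrorSet_of_le _ h, override, if_neg]
    show ¬ (l ≤ 2 * n - 1 - i.val ∧ 2 * n - 1 - i.val < r)
    omega

/-- Counting from the nearer end meets only positions of mirror index below `l`, whose coins are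
kept. -/
theorem rank_override_of_lt {l r : ℕ} (a c : Fin n → Bool) {i : Fin (2 * n)}
    (hi : mirrorIndex i < l) :
    rank (mirrorSet (override l r a c)) i = rank (mirrorSet a) i := by
  rcases min_lt_iff.1 hi with h | h
  · unfold rank
    congr 1
    ext j
    simp only [Finset.mem_filter, Finset.mem_univ, true_and]
    refine and_congr_right fun hj => not_congr (mem_mirrorSet_override a c (Or.inl ?_))
    exact min_lt_iff.2 (Or.inl (lt_trans hj h))
  · have h1 := rank_add_card a i
    have h2 := rank_add_card (override l r a c) i
    have : (Finset.univ.filter fun j => i ≤ j ∧ j ∉ mirrorSet (override l r a c)) =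
        (Finset.univ.filter fun j => i ≤ j ∧ j ∉ mirrorSet a) := by
      ext j
      simp only [Finset.mem_filter, Finset.mem_univ, true_and]
      refine and_congr_right fun hj => not_congr (mem_mirrorSet_override a c (Or.inl ?_))
      refine min_lt_iff.2 (Or.inr (lt_of_le_of_lt ?_ h))
      have : i.val ≤ j.val := hj
      omega
    rw [this] at h2
    omega

/-- Of each mirror pair in the block, the left member lies before `i` and the right member after it.
The left one is nonblank exactly when the new coin is `false`. -/
theorem rank_override_of_le {l r : ℕ} (a c : Fin n → Bool) {i : Fin (2 * n)} (hr : r ≤ n)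
    (hi : r ≤ mirrorIndex i) :
    rank (mirrorSet (override l r a c)) i =
      (Finset.univ.filter fun j => (j < i ∧ j ∉ mirrorSet a) ∧ ¬ (l ≤ j.val ∧ j.val < r)).card +
      (Finset.univ.filter fun j : Fin n => (l ≤ j.val ∧ j.val < r) ∧ c j = false).card := by
  have hi2 := i.2
  have hi' := le_min_iff.1 hi
  unfold rank
  rw [← Finset.card_filter_add_card_filter_not (fun j : Fin (2 * n) => l ≤ j.val ∧ j.val < r),
    add_comm, Finset.filter_filter, Finset.filter_filter]
  congr 1
  · congr 1
    ext j
    simp only [Finset.mem_filter, Finset.mem_univ, true_and]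
    constructor
    · rintro ⟨⟨h1, h2⟩, h3⟩
      refine ⟨⟨h1, ?_⟩, h3⟩
      rwa [mem_mirrorSet_override] at h2
      have : j.val < i.val := h1
      unfold mirrorIndex
      omega
    · rintro ⟨⟨h1, h2⟩, h3⟩
      refine ⟨⟨h1, ?_⟩, h3⟩
      rwa [mem_mirrorSet_override]
      have : j.val < i.val := h1
      unfold mirrorIndex
      omega
  · symm
    refine Finset.card_bij (fun j _ => ⟨j.val, by omega⟩) ?_ ?_ ?_
    · intro j hj
      simp only [Finset.mem_filter, Finset.mem_univ, true_and] at hj ⊢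
      refine ⟨⟨?_, ?_⟩, hj.1⟩
      · rw [Fin.lt_def]; show j.val < i.val; omega
      · rw [mem_mirrorSet_of_lt _ j.2, override]
        simp [hj.1, hj.2]
    · intro j _ j' _ h
      simpa [Fin.ext_iff] using h
    · intro j hj
      simp only [Finset.mem_filter, Finset.mem_univ, true_and] at hj
      have hjn : j.val < n := by omega
      refine ⟨⟨j.val, hjn⟩, ?_, rfl⟩
      simp only [Finset.mem_filter, Finset.mem_univ, true_and]
      refine ⟨hj.2, ?_⟩
      have h2 := hj.1.2
      rw [mem_mirrorSet_of_lt _ hjn, override] at h2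
      simpa [hj.2] using h2

theorem prob_rank_override_eq_le {l r h : ℕ} (a : Fin n → Bool) {i : Fin (2 * n)} (hr : r ≤ n)
    (hlr : r = l + 2 * h) (hi : r ≤ mirrorIndex i) (k : ℕ) :
    prob (fun c => rank (mirrorSet (override l r a c)) i = k) ≤ 1 / √(2 * h + 1) := by
  have hcard : (Finset.univ.filter fun j : Fin n => l ≤ j.val ∧ j.val < r).card = 2 * h := by
    rw [← Finset.card_map Fin.valEmbedding]
    have : (Finset.univ.filter fun j : Fin n => l ≤ j.val ∧ j.val < r).map Fin.valEmbedding =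
        Finset.Ico l r := by
      ext j
      simp only [Finset.mem_map, Finset.mem_filter, Finset.mem_univ, true_and,
        Fin.valEmbedding_apply, Finset.mem_Ico]
      constructor
      · rintro ⟨j, hj, rfl⟩; exact hj
      · intro hj; exact ⟨⟨j, by omega⟩, hj, rfl⟩
    rw [this, Nat.card_Ico]
    omega
  -- The subtraction does not truncate when the event occurs: a rank equal to `k` is at least its
  -- fixed part.
  refine (prob_mono fun c hc => ?_).trans (prob_card_eq_le
    (fun j : Fin n => l ≤ j.val ∧ j.val < r) h (k - (Finset.univ.filter fun j =>
      (j < i ∧ j ∉ mirrorSet a) ∧ ¬ (l ≤ j.val ∧ j.val < r)).card) hcard)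
  rw [rank_override_of_le a c hr hi] at hc
  omega

end Rank

/-! ### Renaming the random letters -/

section Kernel

/-- The map `f p ↦ g p` is well defined and injective on `f '' S`, and a partial injection of a
finite set extends to a permutation. -/
theorem exists_perm_of_kernel_eq {P V : Type*} [Fintype V] (S : Set P) (f g : P → V)
    (h : ∀ p ∈ S, ∀ p' ∈ S, f p = f p' ↔ g p = g p') :
    ∃ σ : V ≃ V, ∀ p ∈ S, σ (f p) = g p := by
  classical
  let s : Finset V := Finset.univ.filter fun v => ∃ p ∈ S, f p = v
  let φ : V → V := fun v => if hv : ∃ p ∈ S, f p = v then g hv.choose else v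
  have hφ : ∀ p ∈ S, φ (f p) = g p := by
    intro p hp
    have hv : ∃ p' ∈ S, f p' = f p := ⟨p, hp, rfl⟩
    simp only [φ, dif_pos hv]
    exact (h _ hv.choose_spec.1 _ hp).1 hv.choose_spec.2
  obtain ⟨e, he⟩ := Finset.exists_equiv_extend_of_card_eq (α := V) (t := Finset.univ)
    (by simp) (s := s) (f := φ) (Finset.subset_univ _) (by
      intro v hv v' hv' hvv
      simp only [s, Finset.coe_filter, Finset.mem_univ, true_and, Set.mem_ofPred_eq] at hv hv'
      obtain ⟨p, hp, rfl⟩ := hv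
      obtain ⟨p', hp', rfl⟩ := hv'
      rw [hφ p hp, hφ p' hp'] at hvv
      exact (h p hp p' hp').2 hvv)
  refine ⟨e.trans (Equiv.subtypeUnivEquiv fun _ => Finset.mem_univ _), fun p hp => ?_⟩
  have := he (f p) (by simpa [s] using ⟨p, hp, rfl⟩)
  simpa [hφ p hp] using this

end Kernel

/-! ### The hybrid and its comparison with both distributions -/

section Hybrid

variable {n : ℕ}

/-- The index, in its string, of a position of a pair of strings. -/
def place : PairIndex (2 * n) → Fin (2 * n) := Sum.elim id id

/-- The bits that determine the blanks of the string that contains the position `p`. -/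
def sideBits (ab : (Fin n → Bool) × (Fin n → Bool)) (p : PairIndex (2 * n)) : Fin n → Bool :=
  Sum.elim (fun _ => ab.1) (fun _ => ab.2) p

/-- The position `p` carries a blank. -/
def Blank (ab : (Fin n → Bool) × (Fin n → Bool)) (p : PairIndex (2 * n)) : Prop :=
  place p ∈ mirrorSet (sideBits ab p)

/-- The index in the truestring of the letter at the position `p`. -/
def pairRank (ab : (Fin n → Bool) × (Fin n → Bool)) (p : PairIndex (2 * n)) : ℕ :=
  rank (mirrorSet (sideBits ab p)) (place p)

/-- The sources of random letters: the letters of the common string, those for the resampled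
part, and an additional one for each position. -/
abbrev Source (n : ℕ) : Type := Fin n ⊕ Fin n ⊕ PairIndex (2 * n)

open Classical in
/-- The pair of strings in which the letter at the nonblank position `p` is read off the
source `src ab p`. -/
noncomputable def reading (src : (Fin n → Bool) × (Fin n → Bool) → PairIndex (2 * n) → Source n)
    (ω : ((Fin n → Bool) × (Fin n → Bool)) × (Source n → Bool)) :
    PairIndex (2 * n) → TernarySymbol :=
  fun p => if Blank ω.1 p then none else some (ω.2 (src ω.1 p))

/-- The source for two strings with the same truestring. -/
def sharedSource (ab : (Fin n → Bool) × (Fin n → Bool)) (p : PairIndex (2 * n)) : Source n :=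
  if h : pairRank ab p < n then Sum.inl ⟨pairRank ab p, h⟩ else Sum.inr (Sum.inr p)

/-- The source for the hybrid in which the letters are shared at the positions of mirror index
less than `l` and independent elsewhere. -/
def hybridSource (l : ℕ) (ab : (Fin n → Bool) × (Fin n → Bool)) (p : PairIndex (2 * n)) :
    Source n :=
  if mirrorIndex (place p) < l then sharedSource ab p else Sum.inr (Sum.inr p)

theorem pairRank_lt {ab : (Fin n → Bool) × (Fin n → Bool)} {p : PairIndex (2 * n)}
    (h : ¬ Blank ab p) : pairRank ab p < n := rank_lt h

/-- Replace the bits for the block of mirror pairs from `l` to `r` in both strings. -/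
def overridePair (l r : ℕ) (x y : (Fin n → Bool) × (Fin n → Bool)) :
    (Fin n → Bool) × (Fin n → Bool) :=
  (override l r x.1 y.1, override l r x.2 y.2)

theorem sideBits_overridePair (l r : ℕ) (x y : (Fin n → Bool) × (Fin n → Bool))
    (p : PairIndex (2 * n)) :
    sideBits (overridePair l r x y) p = override l r (sideBits x p) (sideBits y p) := by
  rcases p with p | p <;> rfl

/-- Beyond the block letters are private, so only the blanks matter there; on the outer side ranks
do not see the block. Hence agreement with constraints outside the block is independent of the
block's coins. -/
theorem reading_hybridSource_overridePair (l r : ℕ) (x y : (Fin n → Bool) × (Fin n → Bool))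
    (v : Source n → Bool) {p : PairIndex (2 * n)}
    (hp : mirrorIndex (place p) < l ∨ r ≤ mirrorIndex (place p)) :
    reading (hybridSource l) (overridePair l r x y, v) p = reading (hybridSource l) (x, v) p := by
  have hb : Blank (overridePair l r x y) p ↔ Blank x p := by
    rw [Blank, sideBits_overridePair, mem_mirrorSet_override _ _ hp, Blank]
  have hs : hybridSource l (overridePair l r x y) p = hybridSource l x p := by
    unfold hybridSource
    split_ifs with h
    · have : pairRank (overridePair l r x y) p = pairRank x p := by
        rw [pairRank, sideBits_overridePair, rank_override_of_lt _ _ h, pairRank]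
      simp only [sharedSource, this]
    · rfl
  unfold reading
  simp only [hs]
  congr 1
  exact propext hb

/-- Two distinct positions read the same letter of the truestring, and the second one is at or
beyond `r`. -/
def Collide (r : ℕ) (ab : (Fin n → Bool) × (Fin n → Bool)) (p p' : PairIndex (2 * n)) : Prop :=
  ¬ Blank ab p ∧ ¬ Blank ab p' ∧ p ≠ p' ∧ r ≤ mirrorIndex (place p') ∧
    pairRank ab p = pairRank ab p'

/-- Distinct nonblank positions of one string have distinct ranks. For different strings, fix the
coins of the one containing `p`; the rank of `p'` is then a constant plus an independent binomial
variable. -/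
theorem prob_collide_le {l r h : ℕ} (hr : r ≤ n) (hlr : r = l + 2 * h)
    (x : (Fin n → Bool) × (Fin n → Bool)) (p p' : PairIndex (2 * n)) :
    prob (fun y => Collide r (overridePair l r x y) p p') ≤ 1 / √(2 * h + 1) := by
  have h0 : (0 : ℝ) ≤ 1 / √(2 * h + 1) := by positivity
  rcases p with i | i <;> rcases p' with i' | i'
  · rw [prob_false]
    · exact h0
    · rintro y ⟨h1, h2, h3, -, h5⟩
      exact h3 (congrArg Sum.inl (rank_injOn h1 h2 h5))
  · by_cases hi : r ≤ mirrorIndex i'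
    · refine (prob_mono fun y (hy : Collide r (overridePair l r x y) _ _) => hy.2.2.2.2.symm).trans
        (prob_prod_le (E := fun y₁ y₂ => rank (mirrorSet (override l r x.2 y₂)) i' =
          rank (mirrorSet (override l r x.1 y₁)) i) fun y₁ => ?_)
      exact prob_rank_override_eq_le x.2 hr hlr hi _
    · rw [prob_false]
      · exact h0
      · exact fun y hy => hi hy.2.2.2.1
  · by_cases hi : r ≤ mirrorIndex i'
    · refine (prob_mono fun y (hy : Collide r (overridePair l r x y) _ _) => hy.2.2.2.2.symm).trans ?_
      refine (prob_prod_swap fun y₁ y₂ => rank (mirrorSet (override l r x.1 y₁)) i' =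
          rank (mirrorSet (override l r x.2 y₂)) i).le.trans
        (prob_prod_le (E := fun y₂ y₁ => rank (mirrorSet (override l r x.1 y₁)) i' =
          rank (mirrorSet (override l r x.2 y₂)) i) fun y₂ => ?_)
      exact prob_rank_override_eq_le x.1 hr hlr hi _
    · rw [prob_false]
      · exact h0
      · exact fun y hy => hi hy.2.2.2.1
  · rw [prob_false]
    · exact h0
    · rintro y ⟨h1, h2, h3, -, h5⟩
      exact h3 (congrArg Sum.inr (rank_injOn h1 h2 h5))

theorem sharedSource_eq_iff {ab : (Fin n → Bool) × (Fin n → Bool)} {p p' : PairIndex (2 * n)}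
    (h : ¬ Blank ab p) (h' : ¬ Blank ab p') :
    sharedSource ab p = sharedSource ab p' ↔ pairRank ab p = pairRank ab p' := by
  simp [sharedSource, pairRank_lt h, pairRank_lt h']

theorem sharedSource_ne {ab : (Fin n → Bool) × (Fin n → Bool)} {p p' : PairIndex (2 * n)}
    (hne : p ≠ p') : sharedSource ab p ≠ Sum.inr (Sum.inr p') := by
  unfold sharedSource
  split_ifs with h
  · simp
  · simpa using hne

/-- Uniform letters are invariant under permutations of the sources, so it only matters which
constrained positions share a source. -/
theorem prob_agrees_reading_eq (src src' : (Fin n → Bool) × (Fin n → Bool) →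
      PairIndex (2 * n) → Source n)
    (C : Finset (PairIndex (2 * n) × TernarySymbol)) (ab : (Fin n → Bool) × (Fin n → Bool))
    (h : ∀ p ∈ {p | ¬ Blank ab p ∧ ∃ s, (p, s) ∈ C}, ∀ p' ∈ {p | ¬ Blank ab p ∧ ∃ s, (p, s) ∈ C},
      src ab p = src ab p' ↔ src' ab p = src' ab p') :
    prob (fun v => Agrees C (reading src (ab, v))) =
      prob (fun v => Agrees C (reading src' (ab, v))) := by
  classical
  obtain ⟨σ, hσ⟩ := exists_perm_of_kernel_eq _ _ _ h
  rw [← prob_equiv (Equiv.arrowCongr σ.symm (Equiv.refl Bool))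
    fun v => Agrees C (reading src (ab, v))]
  refine prob_congr fun v => forall₂_congr fun c hc => ?_
  by_cases hb : Blank ab c.1
  · simp [reading, hb]
  · simp [reading, hb, hσ c.1 ⟨hb, c.2, hc⟩]

/-- Given agreement in the hybrid, the block's coins are still uniform, so by a union bound over
pairs of constraints a collision has conditional probability at most `q²/√(2h+1)`. Without a
collision, `src` and the hybrid identify the same constrained positions: both follow `sharedSource`
on the outer side, and neither identifies a position beyond `r` with another one. The bound is
one-sided because agreement under `src` need not be independent of the block's coins. -/
theorem mul_prob_agrees_hybrid_le {l r h q : ℕ} (hr : r ≤ n) (hlr : r = l + 2 * h)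
    (src : (Fin n → Bool) × (Fin n → Bool) → PairIndex (2 * n) → Source n)
    (hsrc : ∀ ab p p', ¬ Blank ab p → ¬ Blank ab p' → src ab p = src ab p' →
      pairRank ab p = pairRank ab p')
    (hleft : ∀ ab p, ¬ Blank ab p → mirrorIndex (place p) < l → src ab p = sharedSource ab p)
    (C : Finset (PairIndex (2 * n) × TernarySymbol)) (hq : C.card ≤ q)
    (hC : ∀ c ∈ C, mirrorIndex (place c.1) < l ∨ r ≤ mirrorIndex (place c.1)) :
    (1 - (q : ℝ) ^ 2 * (1 / √(2 * h + 1))) *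
        prob (fun ω => Agrees C (reading (hybridSource l) ω)) ≤
      prob (fun ω => Agrees C (reading src ω)) := by
  classical
  set δ : ℝ := 1 / √(2 * h + 1) with hδ
  set z := prob fun ω => Agrees C (reading (hybridSource l) ω) with hz
  have hz0 : 0 ≤ z := prob_nonneg _
  let Bad : (Fin n → Bool) × (Fin n → Bool) → Prop := fun ab =>
    ∃ d ∈ C ×ˢ C, Collide r ab d.1.1 d.2.1
  have hbad : prob (fun ω : ((Fin n → Bool) × (Fin n → Bool)) × (Source n → Bool) =>
      Agrees C (reading (hybridSource l) ω) ∧ Bad ω.1) ≤ (q : ℝ) ^ 2 * δ * z := by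
    refine (prob_mono (F := fun ω => ∃ d ∈ C ×ˢ C,
      Agrees C (reading (hybridSource l) ω) ∧ Collide r ω.1 d.1.1 d.2.1) ?_).trans
      ((prob_exists_mem_le (C ×ˢ C) _ (δ * z) fun d _ => ?_).trans ?_)
    · rintro ω ⟨h1, d, h2, h3⟩
      exact ⟨d, h2, h1, h3⟩
    · refine prob_and_le_of_resample (overridePair l r)
        (fun x y => by simp [overridePair, override_override])
        (fun ab v => Agrees C (reading (hybridSource l) (ab, v)))
        (fun ab _ => Collide r ab d.1.1 d.2.1) δ (fun x y v => ?_)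
        (fun x _ => prob_collide_le hr hlr x _ _)
      refine forall₂_congr fun c hc => ?_
      rw [reading_hybridSource_overridePair l r x y v (hC c hc)]
    · rw [Finset.card_product, ← sq, ← mul_assoc]
      push_cast
      gcongr
  have hgood : prob (fun ω : ((Fin n → Bool) × (Fin n → Bool)) × (Source n → Bool) =>
      Agrees C (reading (hybridSource l) ω) ∧ ¬ Bad ω.1) ≤
      prob (fun ω => Agrees C (reading src ω)) := by
    refine prob_prod_mono (E := fun ab v => Agrees C (reading (hybridSource l) (ab, v)) ∧ ¬ Bad ab)
      (F := fun ab v => Agrees C (reading src (ab, v))) fun ab => ?_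
    by_cases hb : Bad ab
    · rw [prob_false (by simp [hb])]
      exact prob_nonneg _
    · refine (prob_mono fun v hv => hv.1).trans (prob_agrees_reading_eq _ _ C ab ?_).le
      have hrl : l ≤ r := by omega
      have hne : ∀ p p', ¬ Blank ab p → ¬ Blank ab p' → (∃ s, (p, s) ∈ C) → (∃ s, (p', s) ∈ C) →
          p ≠ p' → r ≤ mirrorIndex (place p') → pairRank ab p ≠ pairRank ab p' :=
        fun p p' h1 h2 ⟨s, hs⟩ ⟨s', hs'⟩ h3 h4 h5 =>
          hb ⟨((p, s), (p', s')), Finset.mk_mem_product hs hs', h1, h2, h3, h4, h5⟩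
      rintro p ⟨h1, s, hs⟩ p' ⟨h2, s', hs'⟩
      by_cases hpp : p = p'
      · simp [hpp]
      rcases hC _ hs with hp | hp
      · rcases hC _ hs' with hp' | hp'
        · simp only at hp hp'
          rw [hleft ab p h1 hp, hleft ab p' h2 hp', hybridSource, if_pos hp, hybridSource,
            if_pos hp']
        · simp only at hp hp'
          rw [hybridSource, if_pos hp, hybridSource, if_neg (by omega)]
          exact iff_of_false (sharedSource_ne hpp) fun e =>
            hne p p' h1 h2 ⟨s, hs⟩ ⟨s', hs'⟩ hpp hp' (hsrc ab p p' h1 h2 e)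
      · simp only at hp
        rw [hybridSource, if_neg (by omega)]
        refine iff_of_false ?_ fun e =>
          hne p' p h2 h1 ⟨s', hs'⟩ ⟨s, hs⟩ (Ne.symm hpp) hp (hsrc ab p p' h1 h2 e).symm
        unfold hybridSource
        split_ifs
        · exact (sharedSource_ne (Ne.symm hpp)).symm
        · simpa using hpp
  have hsplit := prob_or_le (fun ω : ((Fin n → Bool) × (Fin n → Bool)) × (Source n → Bool) =>
      Agrees C (reading (hybridSource l) ω) ∧ Bad ω.1)
    (fun ω => Agrees C (reading (hybridSource l) ω) ∧ ¬ Bad ω.1)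
  rw [prob_congr (F := fun ω => Agrees C (reading (hybridSource l) ω))
    (fun ω => by rw [← and_or_left]; exact and_iff_left (Classical.em _))] at hsplit
  rw [one_sub_mul]
  linarith

/-- The source for the negative distribution: in the second string, the middle letters are those
for the resampled part. -/
def resampledSource (ab : (Fin n → Bool) × (Fin n → Bool)) (p : PairIndex (2 * n)) : Source n :=
  if h : p.isRight = true ∧ (2 * n < 5 * (pairRank ab p + 1) ∧ 5 * (pairRank ab p + 1) < 3 * n) then
    Sum.inr (Sum.inl ⟨pairRank ab p, by omega⟩) else sharedSource ab p

theorem pairRank_eq_of_resampledSource_eq {ab : (Fin n → Bool) × (Fin n → Bool)}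
    {p p' : PairIndex (2 * n)} (h : ¬ Blank ab p) (h' : ¬ Blank ab p')
    (e : resampledSource ab p = resampledSource ab p') : pairRank ab p = pairRank ab p' := by
  unfold resampledSource at e
  split_ifs at e
  · simpa using e
  · simp [sharedSource, pairRank_lt h'] at e
  · simp [sharedSource, pairRank_lt h] at e
  · exact (sharedSource_eq_iff h h').1 e

/-- Ranks this close to an end are below `2n/5` or at least `3n/5`, which misses the redrawn
letters. -/
theorem resampledSource_of_lt {l : ℕ} (hl : 5 * l ≤ 2 * n) {ab : (Fin n → Bool) × (Fin n → Bool)}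
    {p : PairIndex (2 * n)} (hp : mirrorIndex (place p) < l) :
    resampledSource ab p = sharedSource ab p := by
  have : pairRank ab p < l ∨ n ≤ pairRank ab p + l := rank_lt_or_le hp
  rw [resampledSource, dif_neg]
  omega

theorem spread_of_mem (u : Fin n → Bool) {U : Finset (Fin (2 * n))} {i : Fin (2 * n)}
    (hi : i ∈ U) : spread u U i = none := if_pos hi

theorem spread_of_notMem (u : Fin n → Bool) {U : Finset (Fin (2 * n))} {i : Fin (2 * n)}
    (hi : i ∉ U) (h : rank U i < n) : spread u U i = some (u ⟨rank U i, h⟩) := by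
  rw [spread, if_neg hi]
  change (List.ofFn u)[rank U i]? = _
  rw [List.getElem?_eq_getElem (by simpa using h)]
  simp

theorem reading_sharedSource (ab : (Fin n → Bool) × (Fin n → Bool)) (v : Source n → Bool) :
    reading sharedSource (ab, v) = Sum.elim (spread (fun i => v (Sum.inl i)) (mirrorSet ab.1))
      (spread (fun i => v (Sum.inl i)) (mirrorSet ab.2)) := by
  funext p
  by_cases hb : Blank ab p
  · rw [reading, if_pos hb]
    rcases p with i | i <;> exact (spread_of_mem _ hb).symm
  · have hr := pairRank_lt hb
    rw [reading, if_neg hb, sharedSource, dif_pos hr]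
    rcases p with i | i <;> exact (spread_of_notMem (fun i => v (Sum.inl i)) hb hr).symm

theorem reading_resampledSource (ab : (Fin n → Bool) × (Fin n → Bool)) (v : Source n → Bool) :
    reading resampledSource (ab, v) =
      Sum.elim (spread (fun i => v (Sum.inl i)) (mirrorSet ab.1))
      (spread (resample (fun i => v (Sum.inl i)) fun i => v (Sum.inr (Sum.inl i)))
        (mirrorSet ab.2)) := by
  funext p
  by_cases hb : Blank ab p
  · rw [reading, if_pos hb]
    rcases p with i | i <;> exact (spread_of_mem _ hb).symm
  · have hr := pairRank_lt hb
    rw [reading, if_neg hb]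
    rcases p with i | i
    · refine Eq.trans ?_ (spread_of_notMem _ hb hr).symm
      simp only [resampledSource, Sum.isRight_inl, Bool.false_eq_true, false_and, dite_false,
        sharedSource, dif_pos hr]
      rfl
    · refine Eq.trans ?_ (spread_of_notMem _ hb hr).symm
      simp only [resampledSource, Sum.isRight_inr, true_and, sharedSource, dif_pos hr, resample]
      change _ = some (if 2 * n < 5 * (pairRank ab (Sum.inr i) + 1) ∧
        5 * (pairRank ab (Sum.inr i) + 1) < 3 * n then _ else _)
      split_ifs <;> rfl

end Hybrid

/-! ### Indistinguishability for deterministic algorithms -/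

section Indistinguishable

variable {n : ℕ}

/-- The pair of strings determined by the bits `ω`; for uniform `ω` it has the positive distribution. -/
def positivePair (ω : (Fin n → Bool) × (Fin n → Bool) × (Fin n → Bool)) :
    PairIndex (2 * n) → TernarySymbol :=
  Sum.elim (spread ω.1 (mirrorSet ω.2.1)) (spread ω.1 (mirrorSet ω.2.2))

/-- The pair of strings determined by the bits `ω`; for uniform `ω` it has the negative distribution. -/
def negativePair (ω : (Fin n → Bool) × (Fin n → Bool) × (Fin n → Bool) × (Fin n → Bool)) :
    PairIndex (2 * n) → TernarySymbol :=
  Sum.elim (spread ω.1 (mirrorSet ω.2.2.1)) (spread (resample ω.1 ω.2.1) (mirrorSet ω.2.2.2))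

theorem prob_positivePair (E : (PairIndex (2 * n) → TernarySymbol) → Prop) :
    prob (fun ω => E (reading (n := n) sharedSource ω)) = prob fun ω => E (positivePair ω) := by
  let e : ((Fin n → Bool) × (Fin n → Bool)) × (Source n → Bool) ≃
      ((Fin n → Bool) × (Fin n → Bool) × (Fin n → Bool)) × (Fin n ⊕ PairIndex (2 * n) → Bool) :=
    ((Equiv.refl _).prodCongr (Equiv.sumArrowEquivProdArrow _ _ _)).trans
      (((Equiv.prodAssoc _ _ _).symm).trans ((Equiv.prodComm _ _).prodCongr (Equiv.refl _)))
  rw [← prob_comp_fst (Ω' := Fin n ⊕ PairIndex (2 * n) → Bool) fun ω => E (positivePair ω),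
    ← prob_equiv e]
  refine prob_congr fun ω => ?_
  rw [reading_sharedSource]
  rfl

theorem prob_negativePair (E : (PairIndex (2 * n) → TernarySymbol) → Prop) :
    prob (fun ω => E (reading (n := n) resampledSource ω)) = prob fun ω => E (negativePair ω) := by
  let e : ((Fin n → Bool) × (Fin n → Bool)) × (Source n → Bool) ≃
      ((Fin n → Bool) × (Fin n → Bool) × (Fin n → Bool) × (Fin n → Bool)) ×
        (PairIndex (2 * n) → Bool) :=
    ⟨fun ω => ((fun i => ω.2 (Sum.inl i), fun i => ω.2 (Sum.inr (Sum.inl i)), ω.1),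
        fun p => ω.2 (Sum.inr (Sum.inr p))),
      fun ω => (ω.1.2.2, Sum.elim ω.1.1 (Sum.elim ω.1.2.1 ω.2)),
      fun ω => Prod.ext rfl (funext fun s => by rcases s with s | s | s <;> rfl),
      fun ω => rfl⟩
  rw [← prob_comp_fst (Ω' := PairIndex (2 * n) → Bool) fun ω => E (negativePair ω),
    ← prob_equiv e]
  refine prob_congr fun ω => ?_
  rw [reading_resampledSource]
  rfl

/-- There are `m` blocks of `2h` mirror indices, and `hn` keeps them below `2n/5`. Both
distributions are compared with the same hybrid for each block. -/
theorem abs_prob_eval_sub_le {m h q : ℕ} (hm : 0 < m) (hh : 0 < h) (hn : 5 * (m * h) ≤ n)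
    (t : DecisionTree (PairIndex (2 * n)) TernarySymbol) (ht : ∀ x, t.numQueries x ≤ q) :
    |prob (fun ω => t.eval (positivePair (n := n) ω) = true) -
      prob (fun ω => t.eval (negativePair (n := n) ω) = true)| ≤
      2 * ((q : ℝ) ^ 2 * (1 / √(2 * h + 1))) + q / m := by
  have hδ : 0 ≤ (q : ℝ) ^ 2 * (1 / √(2 * h + 1)) := by positivity
  rw [← prob_positivePair fun x => t.eval x = true, ← prob_negativePair fun x => t.eval x = true]
  let block : PairIndex (2 * n) → ℕ := fun p => mirrorIndex (place p) / (2 * h)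
  have hmul : ∀ k < m, 5 * (2 * h * (k + 1)) ≤ 2 * n := by
    intro k hk
    have : h * (k + 1) ≤ m * h := by rw [mul_comm]; exact Nat.mul_le_mul_right h hk
    calc 5 * (2 * h * (k + 1)) = 2 * (5 * (h * (k + 1))) := by ring
      _ ≤ 2 * n := by omega
  have hblock : ∀ (k : ℕ) (p : PairIndex (2 * n)), block p ≠ k →
      mirrorIndex (place p) < 2 * h * k ∨ 2 * h * (k + 1) ≤ mirrorIndex (place p) := by
    intro k p hp
    rcases lt_or_gt_of_ne hp with h1 | h1
    · left
      rw [mul_comm]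
      exact (Nat.div_lt_iff_lt_mul (by omega)).1 h1
    · right
      rw [mul_comm]
      exact (Nat.le_div_iff_mul_le (by omega)).1 h1
  have hP : ∀ k < m, ∀ C : Finset (PairIndex (2 * n) × TernarySymbol), C.card ≤ q →
      (∀ c ∈ C, block c.1 ≠ k) →
      (1 - (q : ℝ) ^ 2 * (1 / √(2 * h + 1))) *
        prob (fun ω => Agrees C (reading (hybridSource (2 * h * k)) ω)) ≤
      prob (fun ω => Agrees C (reading sharedSource ω)) := fun k hk C hC hCb =>
    mul_prob_agrees_hybrid_le (l := 2 * h * k) (r := 2 * h * (k + 1)) (by linarith [hmul k hk])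
      (by ring) sharedSource (fun ab p p' h1 h2 => (sharedSource_eq_iff h1 h2).1)
      (fun _ _ _ _ => rfl) C hC fun c hc => hblock k _ (hCb c hc)
  have hN : ∀ k < m, ∀ C : Finset (PairIndex (2 * n) × TernarySymbol), C.card ≤ q →
      (∀ c ∈ C, block c.1 ≠ k) →
      (1 - (q : ℝ) ^ 2 * (1 / √(2 * h + 1))) *
        prob (fun ω => Agrees C (reading (hybridSource (2 * h * k)) ω)) ≤
      prob (fun ω => Agrees C (reading resampledSource ω)) := fun k hk C hC hCb =>
    mul_prob_agrees_hybrid_le (l := 2 * h * k) (r := 2 * h * (k + 1)) (by linarith [hmul k hk])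
      (by ring) resampledSource (fun ab p p' h1 h2 => pairRank_eq_of_resampledSource_eq h1 h2)
      (fun ab p _ hp => resampledSource_of_lt (by nlinarith [hmul k hk]) hp)
      C hC fun c hc => hblock k _ (hCb c hc)
  have h1 := prob_eval_sub_le (reading (n := n) sharedSource) (reading resampledSource)
    (fun k => reading (hybridSource (2 * h * k))) block m q hm _ hδ hP hN t ht
  have h2 := prob_eval_sub_le (reading (n := n) resampledSource) (reading sharedSource)
    (fun k => reading (hybridSource (2 * h * k))) block m q hm _ hδ hN hP t ht
  rw [abs_le]
  constructor <;> linarith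

end Indistinguishable

/-! ### Truestrings of spread and padded strings -/

section Truestring

/-- The string `w`, continued by blanks. -/
def extendBlank {N : ℕ} (w : Fin N → TernarySymbol) (i : ℕ) : TernarySymbol :=
  if h : i < N then w ⟨i, h⟩ else none

theorem truestring_eq_filterMap {N : ℕ} (w : Fin N → TernarySymbol) :
    truestring w = (List.range N).filterMap (extendBlank w) := by
  rw [truestring, List.reduceOption, List.ofFn_eq_map, List.filterMap_map,
    ← List.map_coe_finRange_eq_range, List.filterMap_map]
  congr 1
  funext i
  simp [extendBlank]

/-- Each index satisfying `P` contributes the next letter of `L`. With `P` as "nonblank" this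
recovers the truestring of `spread`. -/
theorem filterMap_range_getElem? {α : Type*} (P : ℕ → Prop) [DecidablePred P] (L : List α)
    (N : ℕ) : (List.range N).filterMap (fun i => if P i then L[Nat.count P i]? else none) =
      L.take (Nat.count P N) := by
  induction N with
  | zero => simp
  | succ N ih =>
    rw [List.range_succ, List.filterMap_append, ih, Nat.count_succ]
    by_cases h : P N
    · rw [if_pos h, List.take_add_one]
      congr 1
      cases hL : L[Nat.count P N]? <;> simp [h, hL]
    · simp [h]

theorem card_filter_eq_count {N : ℕ} (U : Finset (Fin N)) (k : ℕ) :
    (Finset.univ.filter fun j : Fin N => j.val < k ∧ j ∉ U).card =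
      Nat.count (fun i => ∃ h : i < N, (⟨i, h⟩ : Fin N) ∉ U) k := by
  rw [Nat.count_eq_card_filter_range, ← Finset.card_map Fin.valEmbedding]
  congr 1
  ext i
  simp only [Finset.mem_map, Finset.mem_filter, Finset.mem_univ, true_and,
    Fin.valEmbedding_apply, Finset.mem_range]
  constructor
  · rintro ⟨j, hj, rfl⟩; exact ⟨hj.1, j.2, hj.2⟩
  · rintro ⟨h1, h2, h3⟩; exact ⟨⟨i, h2⟩, ⟨h1, h3⟩, rfl⟩

theorem truestring_spread {n : ℕ} (u : Fin n → Bool) (U : Finset (Fin (2 * n)))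
    (hU : Uᶜ.card = n) : truestring (spread u U) = List.ofFn u := by
  classical
  have h1 : Nat.count (fun i => ∃ h : i < 2 * n, (⟨i, h⟩ : Fin (2 * n)) ∉ U) (2 * n) = n := by
    rw [← card_filter_eq_count U (2 * n)]
    conv_rhs => rw [← hU]
    congr 1
    ext j
    simp
  have h2 := filterMap_range_getElem? (fun i => ∃ h : i < 2 * n, (⟨i, h⟩ : Fin (2 * n)) ∉ U)
    (List.ofFn u) (2 * n)
  rw [h1, List.take_of_length_le (by simp)] at h2
  rw [truestring_eq_filterMap, ← h2]
  refine List.filterMap_congr fun i hi => ?_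
  have hi' : i < 2 * n := List.mem_range.1 hi
  rw [extendBlank, dif_pos hi', spread, ← card_filter_eq_count U i]
  by_cases h : (⟨i, hi'⟩ : Fin (2 * n)) ∈ U
  · simp [h]
  · simp only [h, not_false_eq_true, hi', exists_const, if_true, if_false]
    rfl

theorem eq_of_reduceOption_eq {α : Type*} (l l' : List (Option α))
    (h : l.map Option.isNone = l'.map Option.isNone) (h' : l.reduceOption = l'.reduceOption) :
    l = l' := by
  induction l generalizing l' with
  | nil => simpa using h.symm
  | cons x l ih =>
    cases l' with
    | nil => simp at h
    | cons y l' =>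
      simp only [List.map_cons, List.cons.injEq] at h
      rcases x with _ | x <;> rcases y with _ | y
      · rw [ih l' h.2 (by simpa using h')]
      · simp at h
      · simp at h
      · simp only [List.reduceOption_cons_of_some, List.cons.injEq] at h'
        rw [h'.1, ih l' h.2 h'.2]

theorem eq_of_truestring_eq {N : ℕ} {v v' : Fin N → TernarySymbol}
    (h : ∀ i, (v i).isNone = (v' i).isNone) (h' : truestring v = truestring v') : v = v' := by
  apply List.ofFn_injective
  refine eq_of_reduceOption_eq _ _ ?_ h'
  rw [List.map_ofFn, List.map_ofFn]
  congr 1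
  funext i
  exact h i

/-- The string `w` of length `k` as a string of length `N ≥ k`, filled up with blanks. -/
def padString {k : ℕ} (N : ℕ) (w : Fin k → TernarySymbol) : Fin N → TernarySymbol :=
  fun i => extendBlank w i

theorem truestring_padString {k N : ℕ} (hN : k ≤ N) (w : Fin k → TernarySymbol) :
    truestring (padString N w) = truestring w := by
  rw [truestring_eq_filterMap, truestring_eq_filterMap]
  have h1 : ∀ i ∈ List.range N, extendBlank (padString N w) i = extendBlank w i := by
    intro i hi
    rw [extendBlank, dif_pos (List.mem_range.1 hi), padString]
  rw [List.filterMap_congr h1]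
  induction N, hN using Nat.le_induction with
  | base => rfl
  | succ N hN ih =>
    rw [List.range_succ, List.filterMap_append, ih fun i hi => by
      rw [extendBlank, dif_pos (List.mem_range.1 hi), padString]]
    simp [extendBlank, not_lt.2 hN]

end Truestring

/-! ### Counting strings near an equivalent pair -/

section Balls

/-- The sum factors over positions, at each of which one symbol agrees with `w` and two differ. -/
theorem sum_pow_hammingDist {N : ℕ} (w : Fin N → TernarySymbol) (x : ℝ) :
    ∑ v : Fin N → TernarySymbol, x ^ hammingDist w v = (1 + 2 * x) ^ N := by
  have h1 : ∀ i, ∑ s : TernarySymbol, (if w i ≠ s then x else 1) = 1 + 2 * x := by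
    intro i
    rcases w i with _ | _ | _ <;> simp [Fintype.sum_option] <;> ring
  have h2 := Finset.prod_univ_sum (fun _ : Fin N => (Finset.univ : Finset TernarySymbol))
    fun i s => if w i ≠ s then x else 1
  simp only [h1, Finset.prod_const, Finset.card_univ, Fintype.card_fin, Fintype.piFinset_univ]
    at h2
  rw [h2]
  refine Finset.sum_congr rfl fun v _ => ?_
  rw [Finset.prod_ite, hammingDist]
  simp

theorem card_ball_le {N : ℕ} (w : Fin N → TernarySymbol) (d : ℕ) {x : ℝ} (hx : 0 < x)
    (hx1 : x ≤ 1) :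
    ((Finset.univ.filter fun v => hammingDist w v ≤ d).card : ℝ) ≤ (1 + 2 * x) ^ N / x ^ d := by
  rw [le_div_iff₀ (by positivity), ← sum_pow_hammingDist w, ← nsmul_eq_mul, ← Finset.sum_const]
  refine (Finset.sum_le_sum fun v hv => ?_).trans
    (Finset.sum_le_sum_of_subset_of_nonneg (Finset.subset_univ _) fun v _ _ => by positivity)
  exact pow_le_pow_of_le_one hx.le hx1 (by simpa using hv)

/-- The pattern of blanks of a string. -/
def pattern {N : ℕ} (v : Fin N → TernarySymbol) : Fin N → TernarySymbol :=
  fun i => (v i).map fun _ => false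

theorem eq_of_pattern_eq {N : ℕ} {v v' : Fin N → TernarySymbol} (h : pattern v = pattern v')
    (h' : truestring v = truestring v') : v = v' :=
  eq_of_truestring_eq (fun i => by simpa [pattern] using congrArg Option.isNone (congrFun h i)) h'

/-- Each `v` is reached from `w` in three moves with at most `V` choices each: `w'` in a ball around
`w`; then `v'`, determined by the truestring of `w'` and a blank pattern in a ball around `D`; then
`v` in a ball around `v'`. Patterns are themselves ternary strings, so the same ball bound applies
to them. -/
theorem card_near_truestringEquivalent_le {N : ℕ} (w D : Fin N → TernarySymbol) (d : ℕ) {x : ℝ}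
    (hx : 0 < x) (hx1 : x ≤ 1) (S : Finset (Fin N → TernarySymbol))
    (hS : ∀ v ∈ S, pattern v = D ∧ ∃ w' v', hammingDist w w' ≤ d ∧ hammingDist v v' ≤ d ∧
      truestring w' = truestring v') :
    (S.card : ℝ) ≤ ((1 + 2 * x) ^ N / x ^ d) ^ 3 := by
  classical
  set V := (1 + 2 * x) ^ N / x ^ d with hV
  have hV0 : 0 ≤ V := by positivity
  let B : (Fin N → TernarySymbol) → Finset (Fin N → TernarySymbol) :=
    fun w => Finset.univ.filter fun v => hammingDist w v ≤ d
  have hB : ∀ w, ((B w).card : ℝ) ≤ V := fun w => card_ball_le w d hx hx1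
  let K : (Fin N → TernarySymbol) → Finset (Fin N → TernarySymbol) := fun w' =>
    Finset.univ.filter fun v' => hammingDist D (pattern v') ≤ d ∧ truestring w' = truestring v'
  have hK : ∀ w', ((K w').card : ℝ) ≤ V := by
    intro w'
    refine le_trans ?_ (hB D)
    norm_cast
    refine Finset.card_le_card_of_injOn pattern ?_ ?_
    · intro v hv
      simp only [K, Finset.coe_filter, Finset.mem_univ, true_and, Set.mem_ofPred_eq] at hv
      simpa [B] using hv.1
    · intro v hv v' hv' h
      simp only [K, Finset.coe_filter, Finset.mem_univ, true_and, Set.mem_ofPred_eq] at hv hv'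
      exact eq_of_pattern_eq h (hv.2.symm.trans hv'.2)
  have hsub : S ⊆ (B w).biUnion fun w' => (K w').biUnion B := by
    intro v hv
    obtain ⟨h1, w', v', h2, h3, h4⟩ := hS v hv
    simp only [Finset.mem_biUnion]
    refine ⟨w', by simpa [B] using h2, v', ?_, by simpa [B, hammingDist_comm] using h3⟩
    simp only [K, Finset.mem_filter, Finset.mem_univ, true_and]
    refine ⟨?_, h4⟩
    rw [← h1]
    exact (hammingDist_comp_le_hammingDist fun _ (s : TernarySymbol) => s.map fun _ => false).trans
      h3
  calc (S.card : ℝ) ≤ (((B w).biUnion fun w' => (K w').biUnion B).card : ℝ) := by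
        exact_mod_cast Finset.card_le_card hsub
    _ ≤ ∑ w' ∈ B w, ∑ v' ∈ K w', ((B v').card : ℝ) := by
        norm_cast
        exact Finset.card_biUnion_le.trans
          (Finset.sum_le_sum fun w' _ => Finset.card_biUnion_le)
    _ ≤ ∑ w' ∈ B w, ∑ v' ∈ K w', V :=
        Finset.sum_le_sum fun w' _ => Finset.sum_le_sum fun v' _ => hB v'
    _ ≤ ∑ w' ∈ B w, V * V := by
        refine Finset.sum_le_sum fun w' _ => ?_
        rw [Finset.sum_const, nsmul_eq_mul]
        exact mul_le_mul_of_nonneg_right (hK w') hV0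
    _ ≤ V * (V * V) := by
        rw [Finset.sum_const, nsmul_eq_mul]
        exact mul_le_mul_of_nonneg_right (hB w) (by positivity)
    _ = V ^ 3 := by ring

end Balls

/-! ### Negative pairs are far from equivalence -/

section Far

variable {n : ℕ}

/-- The positions whose letters are drawn anew for the negative distribution. -/
def Middle (n : ℕ) (i : Fin n) : Prop := 2 * n < 5 * (i.val + 1) ∧ 5 * (i.val + 1) < 3 * n

instance (n : ℕ) : DecidablePred (Middle n) := fun i => by unfold Middle; infer_instance

theorem le_card_middle (n : ℕ) : n ≤ 5 * Fintype.card {i // Middle n i} + 5 := by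
  have h1 : (Finset.Ico (2 * n / 5) ((3 * n - 1) / 5)).card ≤ Fintype.card {i // Middle n i} := by
    rw [Fintype.card_subtype, ← Finset.card_map Fin.valEmbedding]
    refine Finset.card_le_card fun i hi => ?_
    rw [Finset.mem_Ico] at hi
    simp only [Finset.mem_map, Finset.mem_filter, Finset.mem_univ, true_and,
      Fin.valEmbedding_apply]
    refine ⟨⟨i, by omega⟩, ?_, rfl⟩
    unfold Middle
    show 2 * n < 5 * (i + 1) ∧ 5 * (i + 1) < 3 * n
    omega
  rw [Nat.card_Ico] at h1
  omega

/-- The pair of strings `x`, both filled up with blanks to the length `N`. -/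
def padPair (N : ℕ) (x : PairIndex (2 * n) → TernarySymbol) : PairIndex N → TernarySymbol :=
  Sum.elim (padString N fun i => x (Sum.inl i)) (padString N fun i => x (Sum.inr i))

theorem padPair_positivePair_mem {N : ℕ} (hN : 2 * n ≤ N)
    (ω : (Fin n → Bool) × (Fin n → Bool) × (Fin n → Bool)) :
    padPair N (positivePair ω) ∈ truestringEquivalence N := by
  show truestring (padString N (spread ω.1 (mirrorSet ω.2.1))) =
    truestring (padString N (spread ω.1 (mirrorSet ω.2.2)))
  rw [truestring_padString hN, truestring_padString hN,
    truestring_spread _ _ (card_compl_mirrorSet _), truestring_spread _ _ (card_compl_mirrorSet _)]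

theorem hammingDist_inl_le {N : ℕ} (x y : PairIndex N → TernarySymbol) :
    hammingDist (fun i => x (Sum.inl i)) (fun i => y (Sum.inl i)) ≤ hammingDist x y := by
  unfold hammingDist
  exact Finset.card_le_card_of_injOn Sum.inl (fun i => by simp) Sum.inl_injective.injOn

theorem hammingDist_inr_le {N : ℕ} (x y : PairIndex N → TernarySymbol) :
    hammingDist (fun i => x (Sum.inr i)) (fun i => y (Sum.inr i)) ≤ hammingDist x y := by
  unfold hammingDist
  exact Finset.card_le_card_of_injOn Sum.inr (fun i => by simp) Sum.inr_injective.injOn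

theorem pattern_padString_spread {N : ℕ} (u u' : Fin n → Bool) (b : Fin n → Bool) :
    pattern (padString N (spread u (mirrorSet b))) =
      pattern (padString N (spread u' (mirrorSet b))) := by
  funext i
  simp only [pattern, padString, extendBlank]
  split_ifs with h
  · by_cases hi : (⟨i.val, h⟩ : Fin (2 * n)) ∈ mirrorSet b
    · rw [spread_of_mem _ hi, spread_of_mem _ hi]
    · rw [spread_of_notMem _ hi (rank_lt hi), spread_of_notMem _ hi (rank_lt hi)]
      rfl
  · rfl

/-- Only the middle bits of `r` matter; distinct choices give distinct second strings with one
common blank pattern, to which the count of near strings applies. -/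
theorem prob_near_le {N : ℕ} (hN : 2 * n ≤ N) (u a b : Fin n → Bool) (d : ℕ) {x : ℝ} (hx : 0 < x)
    (hx1 : x ≤ 1) :
    prob (fun r : Fin n → Bool => ∃ y ∈ truestringEquivalence N,
      hammingDist (padPair N (negativePair (u, r, a, b))) y ≤ d) ≤
      ((1 + 2 * x) ^ N / x ^ d) ^ 3 / 2 ^ Fintype.card {i // Middle n i} := by
  classical
  let ext : ({i // Middle n i} → Bool) → Fin n → Bool :=
    fun r i => if h : Middle n i then r ⟨i, h⟩ else u i
  have hext : ∀ r, resample u r = ext fun i => r i.1 := by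
    intro r
    funext i
    by_cases h : Middle n i
    · simp only [ext, dif_pos h]; exact if_pos h
    · simp only [ext, dif_neg h]; exact if_neg h
  let near : ({i // Middle n i} → Bool) → Prop := fun r => ∃ y ∈ truestringEquivalence N,
    hammingDist (padPair N (Sum.elim (spread u (mirrorSet a)) (spread (ext r) (mirrorSet b)))) y ≤ d
  have e1 := prob_equiv (Equiv.piEquivPiSubtypeProd (Middle n) fun _ => Bool) fun p => near p.1
  rw [prob_comp_fst near] at e1
  have e2 : prob (fun r : Fin n → Bool => ∃ y ∈ truestringEquivalence N,
      hammingDist (padPair N (negativePair (u, r, a, b))) y ≤ d) = prob near := by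
    rw [← e1]
    refine prob_congr fun r => ?_
    simp only [negativePair, hext, near]
    rfl
  rw [e2, prob, Fintype.card_fun, Fintype.card_bool, Nat.cast_pow, Nat.cast_ofNat]
  gcongr
  let v : ({i // Middle n i} → Bool) → Fin N → TernarySymbol :=
    fun r => padString N (spread (ext r) (mirrorSet b))
  have hv : Function.Injective v := by
    intro r r' h
    have h1 := congrArg truestring h
    simp only [v] at h1
    rw [truestring_padString hN, truestring_padString hN,
      truestring_spread _ _ (card_compl_mirrorSet _),
      truestring_spread _ _ (card_compl_mirrorSet _)] at h1
    have h2 := List.ofFn_injective h1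
    funext i
    have h3 := congrFun h2 i.1
    simpa [ext, i.2] using h3
  rw [← Finset.card_image_of_injective _ hv]
  refine card_near_truestringEquivalent_le (padString N (spread u (mirrorSet a)))
    (pattern (padString N (spread u (mirrorSet b)))) d hx hx1 _ fun v' hv' => ?_
  rw [Finset.mem_image] at hv'
  obtain ⟨r, hr, rfl⟩ := hv'
  obtain ⟨y, hy, hyd⟩ : near r := by simpa only [Finset.mem_filter, Finset.mem_univ, true_and] using hr
  refine ⟨pattern_padString_spread _ _ _, fun i => y (Sum.inl i), fun i => y (Sum.inr i),
    (hammingDist_inl_le _ _).trans hyd, (hammingDist_inr_le _ _).trans hyd, hy⟩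

theorem prob_not_isFar_le {N : ℕ} (hN : 2 * n ≤ N) (hN' : N ≤ 2 * n + 1) {ε : ℝ}
    (hε : ε ≤ 1 / 2000) :
    prob (fun ω => ¬ IsFar ε (truestringEquivalence N) (padPair N (negativePair (n := n) ω))) ≤
      2 ^ (2 - (n : ℝ) / 20) := by
  have hd : ∀ ω, ¬ IsFar ε (truestringEquivalence N) (padPair N (negativePair (n := n) ω)) →
      ∃ y ∈ truestringEquivalence N,
        hammingDist (padPair N (negativePair ω)) y ≤ N / 1000 := by
    intro ω h
    unfold IsFar at h
    push Not at h
    obtain ⟨y, hy, h⟩ := h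
    refine ⟨y, hy, ?_⟩
    rw [Nat.le_div_iff_mul_le (by norm_num)]
    have h1 : (Fintype.card (PairIndex N) : ℝ) = 2 * N := by
      simp; ring
    rw [h1] at h
    have h2 : ε * (2 * N) ≤ 1 / 2000 * (2 * N) := by gcongr
    have h3 : (hammingDist (padPair N (negativePair ω)) y : ℝ) * 1000 ≤ N := by linarith
    exact_mod_cast h3
  refine (prob_mono hd).trans ?_
  have hb : ∀ u a b : Fin n → Bool, prob (fun r : Fin n → Bool =>
      ∃ y ∈ truestringEquivalence N,
        hammingDist (padPair N (negativePair (u, r, a, b))) y ≤ N / 1000) ≤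
      2 ^ (2 - (n : ℝ) / 20) := by
    intro u a b
    -- As `1.01^69 ≤ 2` and `200 ≤ 2^8`, the ball bound is at most `2^(N/69 + 8N/1000)`. Its cube is
    -- about `2^(0.135 n)`, which loses against the `2^(n/5 - 1)` choices of the middle part.
    refine (prob_near_le hN u a b (N / 1000) (x := 1 / 200) (by norm_num) (by norm_num)).trans ?_
    have hN2 : (N : ℝ) ≤ 2 * n + 1 := by exact_mod_cast hN'
    have hm : (n : ℝ) ≤ 5 * Fintype.card {i // Middle n i} + 5 := by
      exact_mod_cast le_card_middle n
    have hd : ((N / 1000 : ℕ) : ℝ) ≤ N / 1000 := by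
      simpa using (Nat.cast_div_le (α := ℝ) (m := N) (n := 1000))
    have h1 : ((1 + 2 * (1 / 200 : ℝ)) ^ N) ≤ 2 ^ ((N : ℝ) / 69) := by
      have : (1 + 2 * (1 / 200 : ℝ)) ≤ 2 ^ ((1 : ℝ) / 69) := by
        rw [one_div (69 : ℝ), Real.le_rpow_inv_iff_of_pos (by norm_num) (by norm_num) (by norm_num)]
        norm_num
      calc ((1 + 2 * (1 / 200 : ℝ)) ^ N) ≤ (2 ^ ((1 : ℝ) / 69)) ^ N := by gcongr
        _ = _ := by rw [← Real.rpow_natCast, ← Real.rpow_mul (by norm_num)]; congr 1; ring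
    have h2 : ((2 : ℝ) ^ (-(8 * (N : ℝ) / 1000))) ≤ (1 / 200 : ℝ) ^ (N / 1000) := by
      calc ((2 : ℝ) ^ (-(8 * (N : ℝ) / 1000))) ≤ 2 ^ (-8 * ((N / 1000 : ℕ) : ℝ)) :=
            Real.rpow_le_rpow_of_exponent_le (by norm_num) (by linarith)
        _ = (2 ^ (-8 : ℝ)) ^ (N / 1000) := by
            rw [Real.rpow_mul (by norm_num), Real.rpow_natCast]
        _ ≤ _ := by
            gcongr
            rw [Real.rpow_neg (by norm_num)]
            norm_num
    have h3 : (2 : ℝ) ^ ((n : ℝ) / 5 - 1) ≤ 2 ^ Fintype.card {i // Middle n i} := by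
      rw [← Real.rpow_natCast]
      exact Real.rpow_le_rpow_of_exponent_le (by norm_num) (by linarith)
    calc ((1 + 2 * (1 / 200 : ℝ)) ^ N / (1 / 200 : ℝ) ^ (N / 1000)) ^ 3 /
          2 ^ Fintype.card {i // Middle n i}
        ≤ (2 ^ ((N : ℝ) / 69) / 2 ^ (-(8 * (N : ℝ) / 1000))) ^ 3 / 2 ^ ((n : ℝ) / 5 - 1) := by
          gcongr
      _ = 2 ^ (((N : ℝ) / 69 - -(8 * (N : ℝ) / 1000)) * 3 - ((n : ℝ) / 5 - 1)) := by
          rw [← Real.rpow_sub (by norm_num), ← Real.rpow_natCast, ← Real.rpow_mul (by norm_num),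
            ← Real.rpow_sub (by norm_num)]
          norm_num
      _ ≤ _ := Real.rpow_le_rpow_of_exponent_le (by norm_num) (by linarith)
  let e : (Fin n → Bool) × (Fin n → Bool) × (Fin n → Bool) × (Fin n → Bool) ≃
      ((Fin n → Bool) × (Fin n → Bool) × (Fin n → Bool)) × (Fin n → Bool) :=
    ⟨fun ω => ((ω.1, ω.2.2), ω.2.1), fun ω => (ω.1.1, ω.2, ω.1.2), fun _ => rfl, fun _ => rfl⟩
  rw [← prob_equiv e.symm]
  exact prob_prod_le (E := fun (uab : (Fin n → Bool) × (Fin n → Bool) × (Fin n → Bool))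
    (r : Fin n → Bool) => ∃ y ∈ truestringEquivalence N,
      hammingDist (padPair N (negativePair (uab.1, r, uab.2))) y ≤ N / 1000)
    fun uab => hb _ _ _

end Far

open scoped ENNReal

/-! ### Acceptance probabilities of randomized algorithms -/

section Acceptance

variable {I A : Type} {Ω : Type} [Fintype Ω] [Nonempty Ω]

theorem map_uniformOfFintype_apply_true (f : Ω → Bool) :
    ((PMF.uniformOfFintype Ω).map f) true = ENNReal.ofReal (prob fun ω => f ω = true) := by
  classical
  rw [PMF.map_apply, tsum_fintype, prob, ENNReal.ofReal_div_of_pos (by simp [Fintype.card_pos]),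
    ENNReal.ofReal_natCast, ENNReal.ofReal_natCast]
  simp only [PMF.uniformOfFintype_apply, eq_comm (a := true)]
  rw [← Finset.sum_filter, Finset.sum_const, nsmul_eq_mul, ENNReal.div_eq_inv_mul, mul_comm]
  congr

/-- Input and coin tosses are independent, so the input can be averaged first; this reduces to
deterministic trees. -/
theorem acceptProbOn_map_eq_tsum (𝒜 : RandomizedAlgorithm I A) (F : Ω → I → A) :
    acceptProbOn 𝒜 ((PMF.uniformOfFintype Ω).map F) =
      (∑' t, 𝒜 t * ENNReal.ofReal (prob fun ω => t.eval (F ω) = true)).toReal := by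
  unfold acceptProbOn
  congr 1
  have h1 : (((PMF.uniformOfFintype Ω).map F).bind fun x => 𝒜.map fun t => t.eval x) =
      𝒜.bind fun t => (PMF.uniformOfFintype Ω).map fun ω => t.eval (F ω) := by
    rw [PMF.bind_map]
    simp only [PMF.map, Function.comp_def]
    rw [PMF.bind_comm]
  rw [h1, PMF.bind_apply]
  simp only [map_uniformOfFintype_apply_true]

theorem acceptProbOn_map_eq_sum (𝒜 : RandomizedAlgorithm I A) (F : Ω → I → A) :
    acceptProbOn 𝒜 ((PMF.uniformOfFintype Ω).map F) =
      (∑ ω, acceptProb 𝒜 (F ω)) / Fintype.card Ω := by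
  unfold acceptProbOn acceptProb
  rw [PMF.bind_map, PMF.bind_apply, tsum_fintype, ENNReal.toReal_sum fun ω _ =>
    ENNReal.mul_ne_top (PMF.apply_ne_top _ _) (PMF.apply_ne_top _ _), Finset.sum_div]
  refine Finset.sum_congr rfl fun ω _ => ?_
  rw [ENNReal.toReal_mul, PMF.uniformOfFintype_apply, ENNReal.toReal_inv, ENNReal.toReal_natCast,
    div_eq_inv_mul]
  rfl

theorem acceptProb_le_one (𝒜 : RandomizedAlgorithm I A) (x : I → A) : acceptProb 𝒜 x ≤ 1 :=
  ENNReal.toReal_le_of_le_ofReal zero_le_one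
    ((PMF.coe_le_one _ _).trans_eq ENNReal.ofReal_one.symm)

theorem le_acceptProbOn_map (𝒜 : RandomizedAlgorithm I A) (F : Ω → I → A) {c : ℝ}
    (h : ∀ ω, c ≤ acceptProb 𝒜 (F ω)) :
    c ≤ acceptProbOn 𝒜 ((PMF.uniformOfFintype Ω).map F) := by
  rw [acceptProbOn_map_eq_sum, le_div_iff₀ (by exact_mod_cast Fintype.card_pos)]
  calc c * Fintype.card Ω = ∑ ω : Ω, c := by simp [mul_comm]
    _ ≤ _ := Finset.sum_le_sum fun ω _ => h ω

theorem acceptProbOn_map_le (𝒜 : RandomizedAlgorithm I A) (F : Ω → I → A) {c : ℝ} (hc : 0 ≤ c)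
    (E : Ω → Prop) (h : ∀ ω, ¬ E ω → acceptProb 𝒜 (F ω) ≤ c) :
    acceptProbOn 𝒜 ((PMF.uniformOfFintype Ω).map F) ≤ c + prob E := by
  classical
  have h0 : (0 : ℝ) < Fintype.card Ω := by exact_mod_cast Fintype.card_pos
  rw [acceptProbOn_map_eq_sum, prob, div_le_iff₀ h0, add_mul, div_mul_cancel₀ _ h0.ne']
  calc ∑ ω, acceptProb 𝒜 (F ω) ≤ ∑ ω : Ω, (c + if E ω then 1 else 0) := by
        refine Finset.sum_le_sum fun ω _ => ?_
        split_ifs with hE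
        · linarith [acceptProb_le_one 𝒜 (F ω)]
        · simpa using h ω hE
    _ = _ := by
        rw [Finset.sum_add_distrib, Finset.sum_const, Finset.sum_boole, Finset.card_univ,
          nsmul_eq_mul, mul_comm]

theorem acceptProbOn_map_sub_le {Ω' : Type} [Fintype Ω'] [Nonempty Ω']
    (𝒜 : RandomizedAlgorithm I A) (F : Ω → I → A) (F' : Ω' → I → A) {c : ℝ} (hc : 0 ≤ c)
    (h : ∀ t ∈ 𝒜.support, prob (fun ω => t.eval (F ω) = true) ≤
      prob (fun ω => t.eval (F' ω) = true) + c) :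
    acceptProbOn 𝒜 ((PMF.uniformOfFintype Ω).map F) ≤
      acceptProbOn 𝒜 ((PMF.uniformOfFintype Ω').map F') + c := by
  rw [acceptProbOn_map_eq_tsum, acceptProbOn_map_eq_tsum]
  have hfin : ∑' t, 𝒜 t * ENNReal.ofReal (prob fun ω => t.eval (F' ω) = true) ≠ ∞ := by
    refine ne_top_of_le_ne_top ENNReal.one_ne_top ?_
    rw [← 𝒜.tsum_coe]
    refine ENNReal.tsum_le_tsum fun t => ?_
    exact mul_le_of_le_one_right' (by simpa using prob_le_one _)
  have hle : ∑' t, 𝒜 t * ENNReal.ofReal (prob fun ω => t.eval (F ω) = true) ≤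
      ∑' t, 𝒜 t * ENNReal.ofReal (prob fun ω => t.eval (F' ω) = true) + ENNReal.ofReal c := by
    calc _ ≤ ∑' t, 𝒜 t * (ENNReal.ofReal (prob fun ω => t.eval (F' ω) = true) +
          ENNReal.ofReal c) := by
          refine ENNReal.tsum_le_tsum fun t => ?_
          by_cases ht : t ∈ 𝒜.support
          · rw [← ENNReal.ofReal_add (prob_nonneg _) hc]
            gcongr
            exact h t ht
          · rw [PMF.mem_support_iff, not_not] at ht
            simp [ht]
      _ = _ := by
          simp only [mul_add]
          rw [ENNReal.tsum_add, ENNReal.tsum_mul_right, 𝒜.tsum_coe, one_mul]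
  calc _ ≤ (∑' t, 𝒜 t * ENNReal.ofReal (prob fun ω => t.eval (F' ω) = true) +
        ENNReal.ofReal c).toReal := ENNReal.toReal_mono (by simp [hfin]) hle
    _ = _ := by rw [ENNReal.toReal_add hfin (by simp), ENNReal.toReal_ofReal hc]

end Acceptance

/-! ### The advantage in terms of `q` and `n` -/

section Bound

variable {n : ℕ}

theorem positiveDist_eq (n : ℕ) :
    positiveDist n = (PMF.uniformOfFintype _).map (positivePair (n := n)) := rfl

theorem negativeDist_eq (n : ℕ) :
    negativeDist n = (PMF.uniformOfFintype _).map (negativePair (n := n)) := rfl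

/-- Take `m = K(q+1)` blocks, positive even for `q = 0`, and `h = n/(5m)`, rounded down. Then `q/m ≤
1/K` and `2h+1 ≥ n/(5m)`. -/
theorem abs_acceptProbOn_sub_le {K q : ℕ} (hK : 0 < K) (hn : 5 * (K * (q + 1)) ≤ n)
    (𝒜 : RandomizedAlgorithm (PairIndex (2 * n)) TernarySymbol) (h𝒜 : MakesAtMost 𝒜 q) :
    |acceptProbOn 𝒜 (positiveDist n) - acceptProbOn 𝒜 (negativeDist n)| ≤
      2 * √(5 * K * ((q + 1 : ℝ) ^ 5 / n)) + 1 / K := by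
  set m := K * (q + 1) with hm
  have hm0 : 0 < m := by positivity
  have hh : 0 < n / (5 * m) := Nat.div_pos hn (by positivity)
  have hn0 : (0 : ℝ) < n := by
    have : 0 < n := by omega
    exact_mod_cast this
  set c : ℝ := 2 * √(5 * K * ((q + 1 : ℝ) ^ 5 / n)) + 1 / K with hc
  have hc0 : 0 ≤ c := by positivity
  have hbound : 2 * ((q : ℝ) ^ 2 * (1 / √(2 * (n / (5 * m) : ℕ) + 1))) + q / m ≤ c := by
    have h1 : (q : ℝ) / m ≤ 1 / K := by
      rw [hm, div_le_div_iff₀ (by positivity) (by positivity)]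
      push_cast
      nlinarith [(Nat.cast_pos (α := ℝ)).2 hK]
    have h2 : (n : ℝ) / (5 * K * (q + 1)) ≤ 2 * (n / (5 * m) : ℕ) + 1 := by
      rw [div_le_iff₀ (by positivity)]
      have : n ≤ (2 * (n / (5 * m)) + 1) * (5 * m) := by
        have h3 := Nat.div_add_mod n (5 * m)
        have h4 := Nat.mod_lt n (show 5 * m > 0 by positivity)
        nlinarith
      calc (n : ℝ) ≤ ((2 * (n / (5 * m)) + 1) * (5 * m) : ℕ) := by exact_mod_cast this
        _ = _ := by rw [hm]; push_cast; ring
    have h3 : (q : ℝ) ^ 2 * (1 / √(2 * (n / (5 * m) : ℕ) + 1)) ≤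
        √(5 * K * ((q + 1 : ℝ) ^ 5 / n)) := by
      calc (q : ℝ) ^ 2 * (1 / √(2 * (n / (5 * m) : ℕ) + 1))
          ≤ (q + 1 : ℝ) ^ 2 * (1 / √((n : ℝ) / (5 * K * (q + 1)))) := by
            gcongr
            linarith
        _ = √(((q + 1 : ℝ) ^ 2) ^ 2 / ((n : ℝ) / (5 * K * (q + 1)))) := by
            rw [Real.sqrt_div (sq_nonneg _) _, Real.sqrt_sq (by positivity)]
            ring
        _ = _ := by
            congr 1
            field_simp
    linarith
  have key : ∀ t ∈ 𝒜.support, |prob (fun ω => t.eval (positivePair (n := n) ω) = true) -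
      prob (fun ω => t.eval (negativePair (n := n) ω) = true)| ≤ c := fun t ht =>
    (abs_prob_eval_sub_le hm0 hh (by
      have := Nat.mul_div_le n (5 * m)
      rwa [mul_assoc] at this) t (h𝒜 t ht)).trans hbound
  rw [positiveDist_eq, negativeDist_eq, abs_le]
  have h1 := acceptProbOn_map_sub_le 𝒜 (positivePair (n := n)) negativePair hc0 fun t ht => by
    linarith [(abs_le.1 (key t ht)).2]
  have h2 := acceptProbOn_map_sub_le 𝒜 (negativePair (n := n)) positivePair hc0 fun t ht => by
    linarith [(abs_le.1 (key t ht)).1]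
  constructor <;> linarith

end Bound

/-! ### Padding with blanks, to cover odd lengths -/

section Padding

variable {I I' A : Type}

/-- The algorithm that runs `t` on the extension of its input along `f`, where the positions that
`f` does not send to a position of the input carry the symbol `d`. -/
def DecisionTree.pull (f : I' → Option I) (d : A) :
    DecisionTree I' A → DecisionTree I A
  | .leaf b => .leaf b
  | .query i next =>
    (f i).elim ((next d).pull f d) fun j => .query j fun s => (next s).pull f d

theorem DecisionTree.eval_pull (f : I' → Option I) (d : A) (t : DecisionTree I' A) (x : I → A) :
    (t.pull f d).eval x = t.eval fun i => (f i).elim d x := by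
  induction t with
  | leaf b => rfl
  | query i next ih =>
    cases h : f i with
    | none => simp [pull, eval, h, ih]
    | some j => simp [pull, eval, h, ih]

theorem DecisionTree.numQueries_pull_le (f : I' → Option I) (d : A) (t : DecisionTree I' A)
    (x : I → A) : (t.pull f d).numQueries x ≤ t.numQueries fun i => (f i).elim d x := by
  induction t with
  | leaf b => rfl
  | query i next ih =>
    cases h : f i with
    | none => simpa [pull, numQueries, h] using (ih d).trans (Nat.le_succ _)
    | some j => simpa [pull, numQueries, h] using ih _

/-- The position of a pair of strings of length `k` at a position of the padded pair. -/
def unpad {k N : ℕ} : PairIndex N → Option (PairIndex k) :=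
  Sum.elim (fun i => if h : i.val < k then some (Sum.inl ⟨i.val, h⟩) else none)
    fun i => if h : i.val < k then some (Sum.inr ⟨i.val, h⟩) else none

theorem padPair_eq {n N : ℕ} (x : PairIndex (2 * n) → TernarySymbol) :
    padPair N x = fun p => (unpad p).elim none x := by
  funext p
  rcases p with i | i <;> simp only [padPair, Sum.elim_inl, Sum.elim_inr, padString, extendBlank,
    unpad] <;> split_ifs <;> rfl

theorem acceptProb_map_pull (𝒜 : RandomizedAlgorithm I' A) (f : I' → Option I) (d : A)
    (x : I → A) : acceptProb (𝒜.map fun t => t.pull f d) x =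
      acceptProb 𝒜 fun i => (f i).elim d x := by
  unfold acceptProb
  rw [PMF.map_comp]
  simp only [Function.comp_def, DecisionTree.eval_pull]

theorem MakesAtMost.map_pull {𝒜 : RandomizedAlgorithm I' A} {q : ℕ} (h : MakesAtMost 𝒜 q)
    (f : I' → Option I) (d : A) : MakesAtMost (𝒜.map fun t => t.pull f d) q := by
  intro t ht x
  rw [PMF.mem_support_map_iff] at ht
  obtain ⟨t, ht, rfl⟩ := ht
  exact (t.numQueries_pull_le f d x).trans (h t ht _)

end Padding

/-! ### Choice of constants and conclusion -/

section Main

/-- Run on padded inputs, the tester accepts positive pairs with probability at least `1 - η` and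
negative ones with at most `η` plus the chance of not being far. The gap cannot exceed the
advantage. -/
theorem one_sub_le_of_isTester {n N K q : ℕ} (hN : 2 * n ≤ N) (hN' : N ≤ 2 * n + 1) {ε η : ℝ}
    (hε : ε ≤ 1 / 2000) (hη : 0 ≤ η) (hK : 0 < K) (hn : 5 * (K * (q + 1)) ≤ n)
    (𝒜 : RandomizedAlgorithm (PairIndex N) TernarySymbol)
    (ht : IsTester (truestringEquivalence N) ε η 𝒜) (hq : MakesAtMost 𝒜 q) :
    1 - 2 * η ≤ 2 * √(5 * K * ((q + 1 : ℝ) ^ 5 / n)) + 1 / K + 2 ^ (2 - (n : ℝ) / 20) := by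
  have h1 := abs_acceptProbOn_sub_le hK hn (𝒜.map fun t => t.pull unpad none)
    (hq.map_pull unpad none)
  have h2 : 1 - η ≤ acceptProbOn (𝒜.map fun t => t.pull unpad none) (positiveDist n) := by
    rw [positiveDist_eq]
    refine le_acceptProbOn_map _ _ fun ω => ?_
    rw [acceptProb_map_pull, ← padPair_eq]
    exact ht.accepts_mem _ (padPair_positivePair_mem hN ω)
  have h3 : acceptProbOn (𝒜.map fun t => t.pull unpad none) (negativeDist n) ≤
      η + 2 ^ (2 - (n : ℝ) / 20) := by
    rw [negativeDist_eq]
    refine (acceptProbOn_map_le _ _ hη (fun ω => ¬ IsFar ε (truestringEquivalence N)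
      (padPair N (negativePair (n := n) ω))) fun ω hω => ?_).trans ?_
    · rw [acceptProb_map_pull, ← padPair_eq]
      linarith [ht.rejects_far _ (not_not.1 hω)]
    · gcongr
      exact prob_not_isFar_le hN hN' hε
  linarith [(abs_le.1 h1).2]

theorem rpow_one_fifth_pow_five (n : ℕ) : ((n : ℝ) ^ (1 / 5 : ℝ)) ^ 5 = n := by
  rw [← Real.rpow_natCast, ← Real.rpow_mul (by positivity)]
  norm_num

theorem tendsto_rpow_one_fifth :
    Tendsto (fun n : ℕ => (n : ℝ) ^ (1 / 5 : ℝ)) atTop atTop :=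
  (tendsto_rpow_atTop (by norm_num)).comp tendsto_natCast_atTop_atTop

/-- If `q + 1` is at most a small multiple of `n ^ (1 / 5)`, then the parameters of the bound for
the distinguishing advantage are admissible. -/
theorem advantage_bound_le {n K q : ℕ} {c : ℝ} (hc1 : 5 * K * c ≤ 1)
    (hn1 : 1 ≤ (n : ℝ) ^ (1 / 5 : ℝ)) (hq : (q : ℝ) + 1 ≤ c * (n : ℝ) ^ (1 / 5 : ℝ)) :
    5 * (K * (q + 1)) ≤ n ∧ √(5 * K * ((q + 1 : ℝ) ^ 5 / n)) ≤ √(5 * K * c ^ 5) := by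
  have h5 := rpow_one_fifth_pow_five n
  have hn0 : (0 : ℝ) < n := by rw [← h5]; positivity
  constructor
  · have h1 : (n : ℝ) ^ (1 / 5 : ℝ) ≤ n := by
      conv_rhs => rw [← h5]
      exact le_self_pow₀ hn1 (by norm_num)
    have : (5 : ℝ) * (K * (q + 1)) ≤ n := by
      calc (5 : ℝ) * (K * (q + 1)) ≤ 5 * (K * (c * (n : ℝ) ^ (1 / 5 : ℝ))) := by gcongr
        _ = (5 * K * c) * (n : ℝ) ^ (1 / 5 : ℝ) := by ring
        _ ≤ 1 * n := by gcongr
        _ = n := one_mul _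
    exact_mod_cast this
  · gcongr
    rw [div_le_iff₀ hn0]
    calc ((q : ℝ) + 1) ^ 5 ≤ (c * (n : ℝ) ^ (1 / 5 : ℝ)) ^ 5 := by gcongr
      _ = _ := by rw [mul_pow, h5]

theorem exists_small_const (K : ℕ) {δ : ℝ} (hδ : 0 < δ) :
    ∃ c : ℝ, 0 < c ∧ 5 * K * c ≤ 1 ∧ √(5 * K * c ^ 5) ≤ δ := by
  have h1 : Tendsto (fun c : ℝ => 5 * K * c) (𝓝[>] 0) (𝓝 0) := by
    have : Continuous fun c : ℝ => 5 * (K : ℝ) * c := by fun_prop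
    simpa using this.continuousWithinAt.tendsto (x := (0 : ℝ)) (s := Set.Ioi 0)
  have h2 : Tendsto (fun c : ℝ => √(5 * K * c ^ 5)) (𝓝[>] 0) (𝓝 0) := by
    have : Continuous fun c : ℝ => √(5 * (K : ℝ) * c ^ 5) := by fun_prop
    simpa using this.continuousWithinAt.tendsto (x := (0 : ℝ)) (s := Set.Ioi 0)
  obtain ⟨c, ⟨hc1, hc2⟩, hc⟩ := ((h1.eventually_le_const one_pos).and
    (h2.eventually_le_const hδ) |>.and self_mem_nhdsWithin).exists
  exact ⟨c, hc, hc1, hc2⟩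

theorem tendsto_acceptProbOn_sub (q : ℕ → ℕ)
    (hq : (fun n : ℕ => (q n : ℝ)) =o[atTop] (fun n : ℕ => (n : ℝ) ^ (1 / 5 : ℝ)))
    (𝒜 : (n : ℕ) → RandomizedAlgorithm (PairIndex (2 * n)) TernarySymbol)
    (h𝒜 : ∀ n, MakesAtMost (𝒜 n) (q n)) :
    Tendsto (fun n : ℕ => acceptProbOn (𝒜 n) (positiveDist n) -
      acceptProbOn (𝒜 n) (negativeDist n)) atTop (𝓝 0) := by
  rw [Metric.tendsto_nhds]
  intro δ hδ
  -- First `K` makes the term from hitting the block small, then `c`, depending on `K`, the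
  -- collision term.
  obtain ⟨K, hK⟩ := exists_nat_one_div_lt (show 0 < δ / 2 by positivity)
  obtain ⟨c, hc0, hc1, hc2⟩ := exists_small_const (K + 1) (show 0 < δ / 4 by positivity)
  filter_upwards [hq.bound (show 0 < c / 2 by positivity),
    tendsto_rpow_one_fifth.eventually_ge_atTop 1,
    tendsto_rpow_one_fifth.eventually_ge_atTop (2 / c)] with n h1 h2 h3
  rw [Real.norm_of_nonneg (by positivity), Real.norm_of_nonneg (by positivity)] at h1
  rw [div_le_iff₀ hc0] at h3
  obtain ⟨h4, h5⟩ := advantage_bound_le (q := q n) hc1 h2 (by linarith)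
  have h6 := abs_acceptProbOn_sub_le (Nat.succ_pos K) h4 (𝒜 n) (h𝒜 n)
  rw [Real.dist_eq, sub_zero]
  push_cast at h6 h5 hc2
  linarith

theorem query_lower_bound {η : ℝ} (hη : 0 ≤ η) (hη2 : η < 1 / 2) :
    ∃ c : ℝ, 0 < c ∧ ∀ᶠ N : ℕ in atTop, ∀ ε : ℝ, ε ≤ 1 / 2000 →
      ∀ (𝒜 : RandomizedAlgorithm (PairIndex N) TernarySymbol) (q : ℕ),
        IsTester (truestringEquivalence N) ε η 𝒜 → MakesAtMost 𝒜 q →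
          c * (N : ℝ) ^ (1 / 5 : ℝ) ≤ q := by
  have hδ : 0 < 1 - 2 * η := by linarith
  obtain ⟨K, hK⟩ := exists_nat_one_div_lt (show 0 < (1 - 2 * η) / 4 by positivity)
  obtain ⟨c, hc0, hc1, hc2⟩ := exists_small_const (K + 1)
    (show 0 < (1 - 2 * η) / 8 by positivity)
  have hhalf : Tendsto (fun N : ℕ => N / 2) atTop atTop :=
    Nat.tendsto_div_const_atTop (by norm_num)
  have hexp : Tendsto (fun n : ℕ => (2 : ℝ) ^ (2 - (n : ℝ) / 20)) atTop (𝓝 0) := by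
    refine (tendsto_rpow_atBot_of_base_gt_one 2 (by norm_num)).comp ?_
    have : Tendsto (fun n : ℕ => (n : ℝ) / 20) atTop atTop :=
      tendsto_natCast_atTop_atTop.atTop_div_const (by norm_num)
    simpa [sub_eq_add_neg] using
      tendsto_atBot_add_const_left atTop (2 : ℝ) (tendsto_neg_atTop_atBot.comp this)
  -- One factor 2 is lost in passing from `N` to `N / 2`, since `N ≤ 2⁵ * (N / 2)` for `N ≥ 2`, and
  -- one in absorbing the `1` of `q + 1`.
  refine ⟨c / 4, by positivity, ?_⟩
  filter_upwards [(tendsto_rpow_one_fifth.comp hhalf).eventually_ge_atTop 1,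
    (tendsto_rpow_one_fifth.comp hhalf).eventually_ge_atTop (2 / c),
    (hexp.comp hhalf).eventually_lt_const (show 0 < (1 - 2 * η) / 4 by positivity),
    eventually_ge_atTop 2] with N h1 h2 h3 hN2 ε hε 𝒜 q ht hq
  simp only [Function.comp_apply] at h1 h2 h3
  rw [div_le_iff₀ hc0] at h2
  by_contra! hcon
  have h4 : (N : ℝ) ^ (1 / 5 : ℝ) ≤ 2 * ((N / 2 : ℕ) : ℝ) ^ (1 / 5 : ℝ) := by
    refine le_of_pow_le_pow_left₀ (n := 5) (by norm_num) (by positivity) ?_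
    rw [mul_pow, rpow_one_fifth_pow_five, rpow_one_fifth_pow_five]
    have : N ≤ 2 ^ 5 * (N / 2) := by omega
    exact_mod_cast this
  have h5 : c / 4 * (N : ℝ) ^ (1 / 5 : ℝ) ≤ c / 4 * (2 * ((N / 2 : ℕ) : ℝ) ^ (1 / 5 : ℝ)) := by
    gcongr
  obtain ⟨h6, h7⟩ := advantage_bound_le (n := N / 2) (q := q) hc1 h1
    (by linarith)
  have h8 := one_sub_le_of_isTester (n := N / 2) (by omega) (by omega) hε hη (Nat.succ_pos K) h6
    𝒜 ht hq
  push_cast at h7 h8 hc2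
  linarith

end Main

end PropertyTesting

open PropertyTesting
theorem mainTheorem3 :
    (∃ ε₀ : ℝ, 0 < ε₀ ∧
      ∀ η : ℝ, 0 ≤ η → η < 1 / 2 →
        ∃ c : ℝ, 0 < c ∧
          ∀ᶠ n : ℕ in atTop,
            ∀ ε : ℝ, 0 < ε → ε ≤ ε₀ →
              ∀ (𝒜 : RandomizedAlgorithm (PairIndex n) TernarySymbol) (q : ℕ),
                IsTester (truestringEquivalence n) ε η 𝒜 → MakesAtMost 𝒜 q →
                  c * (n : ℝ) ^ (1 / 5 : ℝ) ≤ (q : ℝ)) ∧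
    (∀ q : ℕ → ℕ,
      (fun n : ℕ => (q n : ℝ)) =o[atTop] (fun n : ℕ => (n : ℝ) ^ (1 / 5 : ℝ)) →
        ∀ 𝒜 : (n : ℕ) → RandomizedAlgorithm (PairIndex (2 * n)) TernarySymbol,
          (∀ n, MakesAtMost (𝒜 n) (q n)) →
            Tendsto (fun n : ℕ =>
                acceptProbOn (𝒜 n) (positiveDist n) - acceptProbOn (𝒜 n) (negativeDist n))
              atTop (𝓝 0)) := by
  refine ⟨⟨1 / 2000, by norm_num, fun η hη hη2 => ?_⟩, tendsto_acceptProbOn_sub⟩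
  obtain ⟨c, hc, h⟩ := query_lower_bound hη hη2
  exact ⟨c, hc, h.mono fun N hN ε _ hε => hN ε hε⟩
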